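/- **Setting.** Let $m,k_B,C_r>0$, $\delta\ge 2$, $\beta\in[0,1]$, and let $\rho,T_{tr},T_{int}>0$, $u\in\mathbb R^3$. Put $$M(\xi,I)=\frac{(\rho/m)\,I^{\delta/2-1}}{(2\pi k_BT_{tr}/m)^{3/2}(k_BT_{int})^{\delta/2}\Gamma(\delta/2)}\exp\Big(-\frac{m|\xi-u|^2}{2k_BT_{tr}}-\frac{I}{k_BT_{int}}\Big),\qquad (\xi,I)\in\mathbb R^3\times\mathbb R_+ .$$ For the resonant scattering cross section $\sigma_r=C_r\,(I'I_*')^{\delta/2-1}(I+I_*)^{-(\delta-1-\alpha)}|\xi-\xi_*|^{\beta-1}$ with $\alpha=0$, let $$Q_r(f,F)=\frac12\int_{[0,1]\times S^2\times\mathbb R^3\times\mathbb R_+}\Big(\frac{f'F_*'+f_*'F'}{(I'I_*')^{\delta/2-1}}-\frac{fF_*+f_*F}{(II_*)^{\delta/2-1}}\Big)(II_*)^{\delta/2-1}|\xi-\xi_*|\,\sigma_r\,(I+I_*)\,dr\,d\sigma\,d\xi_*\,dI_*,$$ where $f=f(\xi,I)$, $f_*=f(\xi_*,I_*)$, $f'=f(\xi',I')$,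 $f'_*=f(\xi'_*,I'_*)$ (likewise for $F$), $\xi'=\frac{\xi+\xi_*}2+\frac{|\xi-\xi_*|}2\sigma$, $\xi_*'=\frac{\xi+\xi_*}2-\frac{|\xi-\xi_*|}2\sigma$, $I'=r(I+I_*)$, $I_*'=(1-r)(I+I_*)$. Let $\mathcal L_r h=-2M^{-1}Q_r(M,Mh)$, with domain $L^2((1+|\xi|)^\beta M\,d\xi\,dI)$. Write $c=\xi-u$, and $A_{ij}(c)=c_ic_j-\frac13|c|^2\delta_{ij}$, $B_i(c)=c_i\big(\frac{m|c|^2}{2k_BT_{tr}}-\frac52\big)$, $C_i(c,I)=c_i\big(\frac{I}{k_BT_{int}}-\frac\delta2\big)$. Let $(\mathcal A,\mathcal B,\mathcal C)$ be the coefficient functions of the first-order Chapman–Enskog solution: measurable functions of $(|c|,I)$ such that $A_{ij}\mathcal A(|c|,I)$, $c_i\mathcal B(|c|,I)$, $c_i\mathcal C(|c|,I)$ lie in the domain of $\mathcal L_r$, such that for all $i,j$ $$\mathcal L_r(A_{ij}\mathcal A)=A_{ij},\qquad \mathcal L_r(c_i\mathcal B)=B_i,\qquad \mathcal L_r(c_i\mathcal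 C)=C_i\qquad\text{a.e.},$$ and such that, for $\varphi=\mathcal B$ and $\varphi=\mathcal C$, $$\int_0^\infty\!\!\int_0^\infty c^4\varphi(c,I)\,I^{\delta/2-1}e^{-mc^2/(2k_BT_{tr})-I/(k_BT_{int})}\,dc\,dI=0 .$$ With $K=\dfrac{\rho}{(k_BT_{int})^{\delta/2}\Gamma(\delta/2)}$ and $$J_{k,s}[\varphi]=\int_0^\infty\Big\{\int_0^\infty c^k\varphi(c,I)e^{-mc^2/(2k_BT_{tr})}dc\Big\}I^{s}e^{-I/(k_BT_{int})}dI,$$ the transport coefficients are $$\Lambda_\mu=\tfrac{8}{15\sqrt\pi}\big(\tfrac{m}{2k_BT_{tr}}\big)^{5/2}K\,J_{6,\delta/2-1}[\mathcal A],$$ $$\Lambda_{tr}^{tr}=\tfrac{2}{3\sqrt\pi}\big(\tfrac{m}{2k_BT_{tr}}\big)^{3/2}K\,J_{6,\delta/2-1}[\mathcal B],\qquad \Lambda_{int}^{tr}=\tfrac{2}{3\sqrt\pi}\big(\tfrac{m}{2k_BT_{tr}}\big)^{3/2}K\,J_{6,\delta/2-1}[\mathcal C],$$ $$\Lambda_{tr}^{int}=\tfrac{4}{3\sqrt\pi\,m}\big(\tfrac{m}{2k_BT_{tr}}\big)^{3/2}K\,J_{4,\delta/2}[\mathcal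 B],\qquad \Lambda_{int}^{int}=\tfrac{4}{3\sqrt\pi\,m}\big(\tfrac{m}{2k_BT_{tr}}\big)^{3/2}K\,J_{4,\delta/2}[\mathcal C].$$ **Claim.** There are measurable functions $\mathcal A_0,\mathcal B_0,\mathcal C_0$ of $|c|$ alone such that, for a.e. $(c,I)\in\mathbb R_+\times\mathbb R_+$, $$\mathcal A(c,I)=\mathcal A_0(c),\qquad \mathcal B(c,I)=\mathcal B_0(c),\qquad \mathcal C(c,I)=\Big(\frac{I}{k_BT_{int}}-\frac\delta2\Big)\mathcal C_0(c),$$ and $\int_0^\infty c^4\mathcal B_0(c)e^{-mc^2/(2k_BT_{tr})}dc=0$. All the integrals that define the transport coefficients and those that occur below converge absolutely, $$\Lambda_\mu=\frac{8}{15\sqrt\pi}\,\rho\Big(\frac{m}{2k_BT_{tr}}\Big)^{5/2}\int_0^\infty c^6\mathcal A_0(c)e^{-mc^2/(2k_BT_{tr})}dc,$$ $$\Lambda_{tr}^{tr}=\frac{2}{3\sqrt\pi}\,\rho\Big(\frac{m}{2k_BT_{tr}}\Big)^{3/2}\int_0^\infty c^6\mathcal B_0(c)e^{-mc^2/(2k_BT_{tr})}dc,$$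 $$\Lambda_{int}^{int}=\frac{2}{3\sqrt\pi}\,\delta\,\frac{\rho}{m}\Big(\frac{m}{2k_BT_{tr}}\Big)^{3/2}k_BT_{int}\int_0^\infty c^4\mathcal C_0(c)e^{-mc^2/(2k_BT_{tr})}dc,$$ and the cross-diffusion coefficients vanish: $\Lambda_{int}^{tr}=\Lambda_{tr}^{int}=0$. -/

import Mathlib

open MeasureTheory Set

namespace PolyatomicGas

noncomputable section

/-- Velocity space `ℝ³` with its Euclidean norm. -/
abbrev Vel : Type := EuclideanSpace ℝ (Fin 3)

/-- Molecular constants: mass `m`, Boltzmann constant `kB`, number `δ` of internal degrees of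
freedom, and the parameters `α`, `β`, `Cr` of the resonant scattering cross section. -/
structure Model where
  m : ℝ
  kB : ℝ
  δ : ℝ
  α : ℝ
  β : ℝ
  Cr : ℝ
  m_pos : 0 < m
  kB_pos : 0 < kB
  two_le_δ : 2 ≤ δ
  α_nonneg : 0 ≤ α
  α_lt : α < δ / 2
  β_nonneg : 0 ≤ β
  β_le_one : β ≤ 1
  Cr_pos : 0 < Cr

/-- Values of the macroscopic quantities at a point: mass density, flow velocity, translational
and internal temperature. -/
structure FluidState where
  ρ : ℝ
  u : Vel
  Ttr : ℝ
  Tint : ℝ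
  ρ_pos : 0 < ρ
  Ttr_pos : 0 < Ttr
  Tint_pos : 0 < Tint

/-- Lebesgue measure `dξ dI` on `ℝ³ × ℝ₊`. -/
def phaseMeasure : Measure (Vel × ℝ) :=
  (volume : Measure Vel).prod (volume.restrict (Ioi (0 : ℝ)))

/-- Lebesgue measure `dc dI` on `ℝ₊ × ℝ₊`. -/
def quadrantMeasure : Measure (ℝ × ℝ) :=
  (volume.restrict (Ioi (0 : ℝ))).prod (volume.restrict (Ioi (0 : ℝ)))

/-- The measure `dr dσ dξ_* dI_*` on `[0,1] × S² × ℝ³ × ℝ₊`, where `dσ` is the surface measure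
of the unit sphere (of total mass `4π`). -/
def collisionMeasure : Measure (ℝ × Metric.sphere (0 : Vel) 1 × Vel × ℝ) :=
  (volume.restrict (Icc (0 : ℝ) 1)).prod ((volume : Measure Vel).toSphere.prod phaseMeasure)

/-- The scattering cross section for resonant collisions,
`σ_r = Cr (I' I_*')^{δ/2-1} (I + I_*)^{-(δ-1-α)} |g|^{β-1}`. -/
def sigmaR (P : Model) (absg I Is I' Is' : ℝ) : ℝ :=
  P.Cr * (I' * Is') ^ (P.δ / 2 - 1) / (I + Is) ^ (P.δ - 1 - P.α) * absg ^ (P.β - 1)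

/-- The velocity after a resonant collision, `(ξ + ξ_*)/2 + (|ξ - ξ_*|/2) σ`; the partner has
the velocity with `-σ` in place of `σ`. -/
def postVel (ξ ξs σ : Vel) : Vel :=
  (1 / 2 : ℝ) • (ξ + ξs) + (‖ξ - ξs‖ / 2) • σ

/-- The bilinear operator of resonant collisions in the Borgnakke–Larsen representation:
the energy `I + I_*` of the internal modes is conserved in a collision and is divided into
`I' = r (I + I_*)` and `I_*' = (1 - r) (I + I_*)`. -/
def Qr (P : Model) (f F : Vel → ℝ → ℝ) (ξ : Vel) (I : ℝ) : ℝ :=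
  (1 / 2 : ℝ) * ∫ z : ℝ × Metric.sphere (0 : Vel) 1 × Vel × ℝ,
    (let r : ℝ := z.1
     let σ : Vel := (z.2.1 : Vel)
     let ξs : Vel := z.2.2.1
     let Is : ℝ := z.2.2.2
     let ξ' : Vel := postVel ξ ξs σ
     let ξs' : Vel := postVel ξ ξs (-σ)
     let I' : ℝ := r * (I + Is)
     let Is' : ℝ := (1 - r) * (I + Is)
     ((f ξ' I' * F ξs' Is' + f ξs' Is' * F ξ' I') / (I' * Is') ^ (P.δ / 2 - 1)
        - (f ξ I * F ξs Is + f ξs Is * F ξ I) / (I * Is) ^ (P.δ / 2 - 1))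
      * ((I * Is) ^ (P.δ / 2 - 1) * ‖ξ - ξs‖
        * sigmaR P ‖ξ - ξs‖ I Is I' Is' * (I + Is))) ∂collisionMeasure

/-- The two-temperature local equilibrium distribution, with number density `n = ρ / m`. -/
def Mr (P : Model) (S : FluidState) (ξ : Vel) (I : ℝ) : ℝ :=
  (S.ρ / P.m) * I ^ (P.δ / 2 - 1)
    / ((2 * Real.pi * P.kB * S.Ttr / P.m) ^ (3 / 2 : ℝ) * (P.kB * S.Tint) ^ (P.δ / 2)
        * Real.Gamma (P.δ / 2))
    * Real.exp (-(P.m * ‖ξ - S.u‖ ^ 2 / (2 * P.kB * S.Ttr)) - I / (P.kB * S.Tint))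

/-- The linearized operator of resonant collisions, `L_r h = -2 M_r⁻¹ Q_r(M_r, M_r h)`. -/
def Lr (P : Model) (S : FluidState) (h : Vel → ℝ → ℝ) (ξ : Vel) (I : ℝ) : ℝ :=
  -2 * (Mr P S ξ I)⁻¹ * Qr P (Mr P S) (fun η J => Mr P S η J * h η J) ξ I

/-- The domain `L²((1 + |ξ|)^β (1 + I)^α M_r dξ dI)` of `L_r`. -/
def InDomain (P : Model) (S : FluidState) (h : Vel → ℝ → ℝ) : Prop :=
  MemLp (Function.uncurry h) 2
    (phaseMeasure.withDensity fun z =>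
      ENNReal.ofReal ((1 + ‖z.1‖) ^ P.β * (1 + z.2) ^ P.α * Mr P S z.1 z.2))

/-- `h` is a solution, in the domain of `L_r`, of the equation `L_r h = g`. -/
def Solves (P : Model) (S : FluidState) (h g : Vel → ℝ → ℝ) : Prop :=
  InDomain P S h ∧ ∀ᵐ z ∂phaseMeasure, Lr P S h z.1 z.2 = g z.1 z.2

/-- `A_{ij}(c) = c_i c_j - |c|² δ_{ij} / 3`. -/
def Aij (i j : Fin 3) (c : Vel) : ℝ :=
  c i * c j - (1 / 3 : ℝ) * ‖c‖ ^ 2 * (if i = j then 1 else 0)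

/-- `B_i(c) = c_i (m |c|² / (2 kB T_tr) - 5/2)`. -/
def Bi (P : Model) (S : FluidState) (i : Fin 3) (c : Vel) : ℝ :=
  c i * (P.m * ‖c‖ ^ 2 / (2 * P.kB * S.Ttr) - 5 / 2)

/-- `C_i(c, I) = c_i (I / (kB T_int) - δ/2)`. -/
def Ci (P : Model) (S : FluidState) (i : Fin 3) (c : Vel) (I : ℝ) : ℝ :=
  c i * (I / (P.kB * S.Tint) - P.δ / 2)

/-- The factor `exp(-m c² / (2 kB T_tr))`. -/
def expTr (P : Model) (S : FluidState) (c : ℝ) : ℝ :=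
  Real.exp (-(P.m * c ^ 2 / (2 * P.kB * S.Ttr)))

/-- The factor `exp(-I / (kB T_int))`. -/
def expInt (P : Model) (S : FluidState) (I : ℝ) : ℝ :=
  Real.exp (-(I / (P.kB * S.Tint)))

/-- The constraint
`∫_{ℝ₊ × ℝ₊} c⁴ φ(c, I) I^{δ/2-1} exp(-m c²/(2 kB T_tr) - I/(kB T_int)) dc dI = 0`. -/
def Constraint (P : Model) (S : FluidState) (φ : ℝ → ℝ → ℝ) : Prop :=
  ∫ z : ℝ × ℝ, z.1 ^ 4 * φ z.1 z.2 * z.2 ^ (P.δ / 2 - 1) * expTr P S z.1 * expInt P S z.2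
    ∂quadrantMeasure = 0

/-- `(𝒜, ℬ, 𝒞)` are the coefficient functions of the first-order Chapman–Enskog solution:
with `c = ξ - u`, the functions `A_{ij}(c) 𝒜(|c|, I)`, `c_i ℬ(|c|, I)`, `c_i 𝒞(|c|, I)` lie in the
domain of `L_r` and are mapped by `L_r` to `A_{ij}(c)`, `B_i(c)`, `C_i(c, I)`, and
`ℬ`, `𝒞` satisfy the constraint. -/
structure IsChapmanEnskog (P : Model) (S : FluidState) (𝒜 ℬ 𝒞 : ℝ → ℝ → ℝ) : Prop where
  measurable_A : Measurable (Function.uncurry 𝒜)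
  measurable_B : Measurable (Function.uncurry ℬ)
  measurable_C : Measurable (Function.uncurry 𝒞)
  eq_A : ∀ i j : Fin 3, Solves P S (fun ξ I => Aij i j (ξ - S.u) * 𝒜 ‖ξ - S.u‖ I)
    (fun ξ _ => Aij i j (ξ - S.u))
  eq_B : ∀ i : Fin 3, Solves P S (fun ξ I => (ξ - S.u) i * ℬ ‖ξ - S.u‖ I)
    (fun ξ _ => Bi P S i (ξ - S.u))
  eq_C : ∀ i : Fin 3, Solves P S (fun ξ I => (ξ - S.u) i * 𝒞 ‖ξ - S.u‖ I)
    (fun ξ I => Ci P S i (ξ - S.u) I)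
  constraint_B : Constraint P S ℬ
  constraint_C : Constraint P S 𝒞

/-- The viscosity coefficient `Λ_μ`. -/
def LambdaMu (P : Model) (S : FluidState) (𝒜 : ℝ → ℝ → ℝ) : ℝ :=
  8 / (15 * √Real.pi) * (P.m / (2 * P.kB * S.Ttr)) ^ (5 / 2 : ℝ)
    * (S.ρ / ((P.kB * S.Tint) ^ (P.δ / 2) * Real.Gamma (P.δ / 2)))
    * ∫ I in Ioi (0 : ℝ), (∫ c in Ioi (0 : ℝ), c ^ 6 * 𝒜 c I * expTr P S c)
        * I ^ (P.δ / 2 - 1) * expInt P S I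

/-- The coefficient of the translational heat flow produced by `φ`. -/
def heatTr (P : Model) (S : FluidState) (φ : ℝ → ℝ → ℝ) : ℝ :=
  2 / (3 * √Real.pi) * (P.m / (2 * P.kB * S.Ttr)) ^ (3 / 2 : ℝ)
    * (S.ρ / ((P.kB * S.Tint) ^ (P.δ / 2) * Real.Gamma (P.δ / 2)))
    * ∫ I in Ioi (0 : ℝ), (∫ c in Ioi (0 : ℝ), c ^ 6 * φ c I * expTr P S c)
        * I ^ (P.δ / 2 - 1) * expInt P S I

/-- The coefficient of the internal heat flow produced by `φ`. -/
def heatInt (P : Model) (S : FluidState) (φ : ℝ → ℝ → ℝ) : ℝ :=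
  4 / (3 * √Real.pi) * (1 / P.m) * (P.m / (2 * P.kB * S.Ttr)) ^ (3 / 2 : ℝ)
    * (S.ρ / ((P.kB * S.Tint) ^ (P.δ / 2) * Real.Gamma (P.δ / 2)))
    * ∫ I in Ioi (0 : ℝ), (∫ c in Ioi (0 : ℝ), c ^ 4 * φ c I * expTr P S c)
        * I ^ (P.δ / 2) * expInt P S I

/-- `Λ_tr^tr`: translational heat flow, gradient of `T_tr`. -/
def LambdaTrTr (P : Model) (S : FluidState) (ℬ : ℝ → ℝ → ℝ) : ℝ := heatTr P S ℬ

/-- `Λ_int^tr` (lower index `int`, upper index `tr`): translational heat flow, gradient of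
`T_int`. -/
def LambdaIntTr (P : Model) (S : FluidState) (𝒞 : ℝ → ℝ → ℝ) : ℝ := heatTr P S 𝒞

/-- `Λ_tr^int` (lower index `tr`, upper index `int`): internal heat flow, gradient of `T_tr`. -/
def LambdaTrInt (P : Model) (S : FluidState) (ℬ : ℝ → ℝ → ℝ) : ℝ := heatInt P S ℬ

/-- `Λ_int^int`: internal heat flow, gradient of `T_int`. -/
def LambdaIntInt (P : Model) (S : FluidState) (𝒞 : ℝ → ℝ → ℝ) : ℝ := heatInt P S 𝒞

/-- The double integral with weight `c^k I^s` that enters a transport coefficient converges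
absolutely. -/
def MomentConverges (P : Model) (S : FluidState) (k : ℕ) (s : ℝ) (φ : ℝ → ℝ → ℝ) : Prop :=
  Integrable (fun z : ℝ × ℝ => z.1 ^ k * φ z.1 z.2 * expTr P S z.1 * z.2 ^ s * expInt P S z.2)
    quadrantMeasure

/-- All the double integrals in the five transport coefficients converge absolutely. -/
def TransportConverges (P : Model) (S : FluidState) (𝒜 ℬ 𝒞 : ℝ → ℝ → ℝ) : Prop :=
  MomentConverges P S 6 (P.δ / 2 - 1) 𝒜 ∧
  MomentConverges P S 6 (P.δ / 2 - 1) ℬ ∧ MomentConverges P S 6 (P.δ / 2 - 1) 𝒞 ∧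
  MomentConverges P S 4 (P.δ / 2) ℬ ∧ MomentConverges P S 4 (P.δ / 2) 𝒞

end

end PolyatomicGas

/-! For `α = 0` a resonant collision acts on velocities and on internal energies independently.
After multiplication by the equilibrium weights, the collision integral becomes integration against
a product law, `totalMeasure`: a velocity pair with density `exp·exp·|ξ-ξ_*|^β`, a uniform `σ`, two
Gamma-distributed energies, and a Beta-distributed ratio `r`. Up to a positive constant, the pairing
of `ψ` with `L_r h` is `∫ ψ (h + h_* - h' - h'_*)` against this law (`integral_mul_defect_eq`).

Two facts about this law carry the proof. Pairs of states before and after a collision are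
equidistributed (`map_pre`, `map_post`), so with `d = h + h_* - h' - h'_*` one has `∫ d² = 4 ∫ h d`;
a function without dissipation is therefore a collision invariant (`defect_ae_eq_zero`). And `r` has
mean `1/2`, so averaging `I'` or `I_*'` over `I_*` and `r` gives an affine function of `I`. Hence,
for the profile `χ = 1` or an affine `χ` of mean zero, `L_r` sends `χ(I) η(ξ)` to a multiple of `χ`
again (`integral_mul_defect_eq_zero`, in weak form).

Now let `L_r h = y(ξ) χ(I)`, where `χ = 1` for `𝒜` and `ℬ`, and `χ = I/(kB T_int) - δ/2` for `𝒞`.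
Let `ψ` be the part of `h` orthogonal to `χ` in the variable `I`. Both `L_r h` and `L_r (h - ψ)` are
orthogonal to `ψ`, so `ψ` has no dissipation and is a collision invariant
(`defect_residual_ae_eq_zero`). It still has the form `A_ij D` or `c_i D`. The outcome of a
collision depends on the incoming pair only through `ξ + ξ_*`, `|ξ - ξ_*|` and `I + I_*`, so the sum
of an invariant over the pair is unchanged when the energies are swapped, or when one coordinate of
the two velocities is swapped. In the tensor case this makes `D` independent of `I`; in the vector
case it makes `D` constant. Orthogonality to `χ = 1`, or the constraint when `χ` is centred, then
gives `D = 0`. So `h` is a multiple of `χ`, which is the claimed separation.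

The transport coefficients then factor into one-dimensional integrals. `Λ_int^tr` contains the
factor `∫ χ I^(δ/2-1) exp(-I/(kB T_int)) dI = 0`, and `Λ_tr^int` contains the reduced constraint on
`ℬ₀`. Convergence follows from Hölder's inequality, since all polynomial moments of the Gaussian and
the Gamma law are finite. -/

namespace PolyatomicGas

noncomputable section

open scoped ENNReal

/-! ### Changes of variables: scattering of velocities and redistribution of internal energy. -/

section SphericalAverages

/-- Integration in spherical coordinates. -/
theorem lintegral_eq_lintegral_toSphere {f : Vel → ℝ≥0∞} (hf : Measurable f) :
    ∫⁻ x, f x = ∫⁻ σ : Metric.sphere (0 : Vel) 1, (∫⁻ r in Ioi (0 : ℝ),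
      ENNReal.ofReal (r ^ 2) * f (r • (σ : Vel))) ∂(volume : Measure Vel).toSphere := by
  have hmp := (volume : Measure Vel).measurePreserving_homeomorphUnitSphereProd
  have hdim : Module.finrank ℝ Vel - 1 = 2 := by simp
  rw [hdim] at hmp
  have h1 : ∫⁻ x, f x = ∫⁻ x : ({(0 : Vel)}ᶜ : Set Vel), f x
      ∂((volume : Measure Vel).comap (↑)) := by
    rw [lintegral_subtype_comap (measurableSet_singleton _).compl, restrict_compl_singleton]
  have hm : Measurable fun p : Metric.sphere (0 : Vel) 1 × Ioi (0 : ℝ) =>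
      f (p.2.1 • (p.1 : Vel)) := by fun_prop
  have h2 := hmp.lintegral_comp hm
  rw [lintegral_prod _ hm.aemeasurable] at h2
  rw [h1]
  refine Eq.trans ?_ (h2.trans ?_)
  · refine lintegral_congr fun x => ?_
    have hx : ‖(x : Vel)‖ ≠ 0 := norm_ne_zero_iff.2 x.2
    simp [homeomorphUnitSphereProd, smul_smul, hx]
  · refine lintegral_congr fun σ => ?_
    rw [Measure.volumeIoiPow, lintegral_withDensity_eq_lintegral_mul _ (by fun_prop) (by fun_prop)]
    simp only [Pi.mul_apply]
    rw [lintegral_subtype_comap measurableSet_Ioi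
      (fun r : ℝ => ENNReal.ofReal (r ^ 2) * f (r • (σ : Vel)))]

/-- The velocities after a collision. -/
def collVel (p : (Vel × Vel) × Metric.sphere (0 : Vel) 1) : Vel × Vel :=
  (postVel p.1.1 p.1.2 p.2, postVel p.1.1 p.1.2 (-(p.2 : Vel)))

@[fun_prop]
theorem measurable_collVel : Measurable collVel := by
  unfold collVel postVel; fun_prop

/-- Passage to the relative velocity `g` and the centre of mass `V`. Both substitutions, `η = ξ - g`
and `ξ = V + g/2`, have Jacobian one. -/
theorem lintegral_vel_pair {Φ : Vel × Vel → ℝ≥0∞} (hΦ : Measurable Φ) :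
    ∫⁻ x, Φ x ∂((volume : Measure Vel).prod volume) =
      ∫⁻ g : Vel, ∫⁻ V : Vel, Φ (V + (1 / 2 : ℝ) • g, V - (1 / 2 : ℝ) • g) := by
  rw [lintegral_prod _ hΦ.aemeasurable]
  have h1 : ∀ ξ : Vel, ∫⁻ η, Φ (ξ, η) = ∫⁻ g, Φ (ξ, ξ - g) := fun ξ =>
    (lintegral_sub_left_eq_self (fun η => Φ (ξ, η)) ξ).symm
  simp_rw [h1]
  rw [lintegral_lintegral_swap (by fun_prop)]
  refine lintegral_congr fun g => ?_
  rw [← lintegral_add_right_eq_self (fun ξ => Φ (ξ, ξ - g)) ((1 / 2 : ℝ) • g)]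
  refine lintegral_congr fun V => ?_
  congr 2
  rw [add_sub_assoc, sub_eq_add_neg V]
  congr 1
  module

/-- In polar coordinates the direction of `g` is uniform and independent of `|g|`, so replacing it
by an independent uniform `σ` changes nothing but the total mass. -/
theorem lintegral_sphere_average {φ : Vel → ℝ≥0∞} (hφ : Measurable φ) :
    ∫⁻ g : Vel, ∫⁻ σ : Metric.sphere (0 : Vel) 1, φ (‖g‖ • (σ : Vel))
        ∂(volume : Measure Vel).toSphere =
      (volume : Measure Vel).toSphere univ * ∫⁻ g, φ g := by
  have hm : Measurable fun g : Vel => ∫⁻ σ : Metric.sphere (0 : Vel) 1, φ (‖g‖ • (σ : Vel))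
        ∂(volume : Measure Vel).toSphere := by
    refine Measurable.lintegral_prod_right'
      (f := fun p : Vel × Metric.sphere (0 : Vel) 1 => φ (‖p.1‖ • (p.2 : Vel))) ?_
    fun_prop
  rw [lintegral_eq_lintegral_toSphere hm, lintegral_eq_lintegral_toSphere hφ]
  rw [lintegral_lintegral_swap
    (f := fun (σ : Metric.sphere (0 : Vel) 1) (r : ℝ) => ENNReal.ofReal (r ^ 2) * φ (r • (σ : Vel)))
    (by fun_prop)]
  have h : ∀ τ : Metric.sphere (0 : Vel) 1,
      (∫⁻ r in Ioi (0 : ℝ), ENNReal.ofReal (r ^ 2) *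
        ∫⁻ σ : Metric.sphere (0 : Vel) 1, φ (‖r • (τ : Vel)‖ • (σ : Vel))
          ∂(volume : Measure Vel).toSphere) =
      ∫⁻ r in Ioi (0 : ℝ), ∫⁻ σ : Metric.sphere (0 : Vel) 1,
        ENNReal.ofReal (r ^ 2) * φ (r • (σ : Vel)) ∂(volume : Measure Vel).toSphere := by
    intro τ
    refine setLIntegral_congr_fun measurableSet_Ioi fun r hr => ?_
    have hn : ‖r • (τ : Vel)‖ = r := by
      rw [norm_smul, norm_eq_of_mem_sphere, mul_one, Real.norm_of_nonneg (le_of_lt hr)]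
    simp only [hn]
    rw [lintegral_const_mul _ (by fun_prop)]
  simp_rw [h]
  rw [lintegral_const, mul_comm]

/-- A collision keeps the centre of mass and replaces the relative velocity `g` by `|g| σ`, so the
claim is the spherical average in the coordinates `(V, g)`. -/
theorem lintegral_collVel {Φ : Vel × Vel → ℝ≥0∞} (hΦ : Measurable Φ) :
    ∫⁻ p, Φ (collVel p) ∂(((volume : Measure Vel).prod volume).prod (volume : Measure Vel).toSphere)
      = (volume : Measure Vel).toSphere univ * ∫⁻ x, Φ x ∂((volume : Measure Vel).prod volume) := by
  rw [lintegral_prod _ (by fun_prop), lintegral_vel_pair hΦ, lintegral_vel_pair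
    (Measurable.lintegral_prod_right' (f := fun p => Φ (collVel p)) (by fun_prop)),
    ← lintegral_sphere_average (φ := fun g => ∫⁻ V : Vel,
      Φ (V + (1 / 2 : ℝ) • g, V - (1 / 2 : ℝ) • g))
      (Measurable.lintegral_prod_right' (f := fun p : Vel × Vel =>
        Φ (p.2 + (1 / 2 : ℝ) • p.1, p.2 - (1 / 2 : ℝ) • p.1)) (by fun_prop))]
  refine lintegral_congr fun g => ?_
  rw [lintegral_lintegral_swap (by fun_prop)]
  refine lintegral_congr fun σ => lintegral_congr fun V => ?_
  congr 1
  have h1 : V + (1 / 2 : ℝ) • g - (V - (1 / 2 : ℝ) • g) = g := by module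
  simp only [collVel, postVel, h1, Prod.mk.injEq]
  constructor <;> module

/-- The relative speed of two velocities is invariant in a collision. -/
theorem norm_postVel_sub (ξ η : Vel) (σ : Metric.sphere (0 : Vel) 1) :
    ‖postVel ξ η σ - postVel ξ η (-(σ : Vel))‖ = ‖ξ - η‖ := by
  have : postVel ξ η σ - postVel ξ η (-(σ : Vel)) = ‖ξ - η‖ • (σ : Vel) := by
    unfold postVel; module
  rw [this, norm_smul, norm_eq_of_mem_sphere, mul_one, norm_norm]

/-- The kinetic energy of two velocities is invariant in a collision. -/
theorem norm_sq_postVel_add (ξ η u : Vel) (σ : Metric.sphere (0 : Vel) 1) :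
    ‖postVel ξ η σ - u‖ ^ 2 + ‖postVel ξ η (-(σ : Vel)) - u‖ ^ 2 =
      ‖ξ - u‖ ^ 2 + ‖η - u‖ ^ 2 := by
  have h1 := parallelogram_law_with_norm ℝ (postVel ξ η σ - u) (postVel ξ η (-(σ : Vel)) - u)
  have h2 := parallelogram_law_with_norm ℝ (ξ - u) (η - u)
  have e1 : postVel ξ η σ - u - (postVel ξ η (-(σ : Vel)) - u) =
      postVel ξ η σ - postVel ξ η (-(σ : Vel)) := by abel
  have e2 : ξ - u - (η - u) = ξ - η := by abel
  have e3 : postVel ξ η σ - u + (postVel ξ η (-(σ : Vel)) - u) = ξ - u + (η - u) := by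
    unfold postVel; module
  rw [e1, e3, norm_postVel_sub] at h1
  rw [e2] at h2
  nlinarith

/-- The energies of the internal modes after a collision. -/
def collInt (p : (ℝ × ℝ) × ℝ) : ℝ × ℝ :=
  (p.2 * (p.1.1 + p.1.2), (1 - p.2) * (p.1.1 + p.1.2))

@[fun_prop]
theorem measurable_collInt : Measurable collInt := by
  unfold collInt; fun_prop

/-- Coordinates adapted to the redistribution of energy: the total `E = x + y` and the fraction `s =
x / E`, with Jacobian `E`. -/
theorem lintegral_Ioi_pair {Φ : ℝ × ℝ → ℝ≥0∞} (hΦ : Measurable Φ) :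
    ∫⁻ x, Φ x ∂((volume.restrict (Ioi (0 : ℝ))).prod (volume.restrict (Ioi (0 : ℝ)))) =
      ∫⁻ E in Ioi (0 : ℝ), ENNReal.ofReal E *
        ∫⁻ s in Ioo (0 : ℝ) 1, Φ (s * E, (1 - s) * E) := by
  rw [Measure.prod_restrict, ← lintegral_indicator (measurableSet_Ioi.prod measurableSet_Ioi)]
  -- Extension by zero to the whole plane, so that translations and scalings need no bookkeeping of
  -- domains; the quadrant reappears as `0 < E`, `0 < s < 1`.
  set Ψ := (Ioi (0 : ℝ) ×ˢ Ioi (0 : ℝ)).indicator Φ with hΨ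
  have hΨm : Measurable Ψ := hΦ.indicator (measurableSet_Ioi.prod measurableSet_Ioi)
  rw [lintegral_prod _ hΨm.aemeasurable]
  have h1 : ∀ x : ℝ, ∫⁻ y, Ψ (x, y) = ∫⁻ E, Ψ (x, E - x) := fun x =>
    (lintegral_sub_right_eq_self (fun y => Ψ (x, y)) x).symm
  simp_rw [h1]
  rw [lintegral_lintegral_swap (by fun_prop), ← lintegral_indicator measurableSet_Ioi]
  refine lintegral_congr fun E => ?_
  by_cases hE : 0 < E
  · rw [indicator_of_mem (mem_Ioi.2 hE)]
    have h2 : ∫⁻ x, Ψ (x, E - x) = ENNReal.ofReal E * ∫⁻ s, Ψ (s * E, E - s * E) := by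
      conv_lhs => rw [← Real.smul_map_volume_mul_right hE.ne']
      rw [lintegral_smul_measure, lintegral_map (by fun_prop) (by fun_prop), abs_of_pos hE,
        smul_eq_mul]
    rw [h2, ← lintegral_indicator measurableSet_Ioo]
    congr 1
    refine lintegral_congr fun s => ?_
    have e : (1 - s) * E = E - s * E := by ring
    by_cases hs : s ∈ Ioo (0 : ℝ) 1
    · rw [indicator_of_mem hs, hΨ, indicator_of_mem, e]
      refine ⟨mul_pos hs.1 hE, ?_⟩
      simp only [mem_Ioi, ← e]
      exact mul_pos (sub_pos.2 hs.2) hE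
    · rw [indicator_of_notMem hs, hΨ, indicator_of_notMem]
      rintro ⟨h3, h4⟩
      simp only [mem_Ioi, ← e] at h3 h4
      exact hs ⟨(pos_iff_pos_of_mul_pos h3).2 hE, sub_pos.1 ((pos_iff_pos_of_mul_pos h4).2 hE)⟩
  · rw [indicator_of_notMem (by simpa using hE)]
    refine (lintegral_congr fun x => ?_).trans lintegral_zero
    rw [hΨ, indicator_of_notMem]
    rintro ⟨h3, h4⟩
    simp only [mem_Ioi] at h3 h4
    exact hE (by linarith)

end SphericalAverages

/-! ### The product law of a collision, and equidistribution before and after. -/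

section Distributions

variable (P : Model) (S : FluidState)

@[fun_prop]
theorem measurable_expTr : Measurable (expTr P S) := by unfold expTr; fun_prop

@[fun_prop]
theorem measurable_expInt : Measurable (expInt P S) := by unfold expInt; fun_prop

theorem expTr_pos (c : ℝ) : 0 < expTr P S c := Real.exp_pos _

theorem expInt_pos (I : ℝ) : 0 < expInt P S I := Real.exp_pos _

/-- The Gaussian measure on velocity space. -/
def velMeasure : Measure Vel :=
  volume.withDensity fun ξ => ENNReal.ofReal (expTr P S ‖ξ - S.u‖)

/-- The density `I^{δ/2-1} exp(-I / (kB T_int))`. -/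
def intWeight (I : ℝ) : ℝ := I ^ (P.δ / 2 - 1) * expInt P S I

@[fun_prop]
theorem measurable_intWeight : Measurable (intWeight P S) := by unfold intWeight; fun_prop

theorem intWeight_pos {I : ℝ} (hI : 0 < I) : 0 < intWeight P S I :=
  mul_pos (Real.rpow_pos_of_pos hI _) (expInt_pos P S I)

/-- The Gamma distribution of the internal energy, not normalized. -/
def intMeasure : Measure ℝ :=
  (volume.restrict (Ioi (0 : ℝ))).withDensity fun I => ENNReal.ofReal (intWeight P S I)

/-- The density of the distribution of the velocities in a collision. -/
def velPairDensity (v : Vel × Vel) : ℝ :=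
  expTr P S ‖v.1 - S.u‖ * expTr P S ‖v.2 - S.u‖ * ‖v.1 - v.2‖ ^ P.β

@[fun_prop]
theorem measurable_velPairDensity : Measurable (velPairDensity P S) := by
  unfold velPairDensity; fun_prop

/-- The distribution of the velocities in a collision. -/
def velPairMeasure : Measure (Vel × Vel) :=
  ((volume : Measure Vel).prod volume).withDensity fun v => ENNReal.ofReal (velPairDensity P S v)

/-- The density of the distribution of the ratio in which internal energy is divided. -/
def betaWeight (r : ℝ) : ℝ := (r * (1 - r)) ^ (P.δ / 2 - 1)

@[fun_prop]
theorem measurable_betaWeight : Measurable (betaWeight P) := by unfold betaWeight; fun_prop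

/-- The distribution of the ratio in which internal energy is divided. -/
def betaMeasure : Measure ℝ :=
  (volume.restrict (Icc (0 : ℝ) 1)).withDensity fun r => ENNReal.ofReal (betaWeight P r)

/-- The surface measure of the unit sphere. -/
abbrev sphereMeasure : Measure (Metric.sphere (0 : Vel) 1) := (volume : Measure Vel).toSphere

instance : SFinite (velMeasure P S) := by unfold velMeasure; infer_instance
instance : SFinite (intMeasure P S) := by unfold intMeasure; infer_instance
instance : SFinite (velPairMeasure P S) := by unfold velPairMeasure; infer_instance
instance : SFinite (betaMeasure P) := by unfold betaMeasure; infer_instance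

/-- The density depends only on the kinetic energy and the relative speed, both of which a collision
conserves. -/
theorem velPairDensity_collVel (p : (Vel × Vel) × Metric.sphere (0 : Vel) 1) :
    velPairDensity P S (collVel p) = velPairDensity P S p.1 := by
  have h := norm_sq_postVel_add p.1.1 p.1.2 S.u p.2
  simp only [velPairDensity, collVel, norm_postVel_sub, expTr, ← Real.exp_add]
  congr 2
  linear_combination (-(P.m / (2 * P.kB * S.Ttr))) * h

theorem lintegral_velPair_collVel {Φ : Vel × Vel → ℝ≥0∞} (hΦ : Measurable Φ) :
    ∫⁻ p, Φ (collVel p) ∂((velPairMeasure P S).prod sphereMeasure) =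
      sphereMeasure univ * ∫⁻ x, Φ x ∂velPairMeasure P S := by
  rw [velPairMeasure, prod_withDensity_left (by fun_prop),
    lintegral_withDensity_eq_lintegral_mul _ (by fun_prop) (by fun_prop),
    lintegral_withDensity_eq_lintegral_mul _ (by fun_prop) (by fun_prop),
    ← lintegral_collVel (by fun_prop)]
  refine lintegral_congr fun p => ?_
  simp only [Pi.mul_apply, velPairDensity_collVel]

theorem map_collVel : ((velPairMeasure P S).prod sphereMeasure).map collVel =
    sphereMeasure univ • velPairMeasure P S := by
  refine Measure.ext_of_lintegral _ fun Φ hΦ => ?_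
  rw [lintegral_map hΦ (by fun_prop), lintegral_velPair_collVel P S hΦ, lintegral_smul_measure,
    smul_eq_mul]

/-- The classical independence of the sum and the ratio of two Gamma variables with the same scale:
the joint density splits into a Beta weight in `s` and a function of `E`. -/
theorem intWeight_mul_intWeight {E s : ℝ} (hE : 0 < E) (hs : s ∈ Ioo (0 : ℝ) 1) :
    intWeight P S (s * E) * intWeight P S ((1 - s) * E) =
      betaWeight P s * ((E * E) ^ (P.δ / 2 - 1) * expInt P S E) := by
  have h1 : 0 < 1 - s := sub_pos.2 hs.2
  have h2 : expInt P S (s * E) * expInt P S ((1 - s) * E) = expInt P S E := by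
    simp only [expInt, ← Real.exp_add]
    congr 1
    ring
  rw [intWeight, intWeight, betaWeight, Real.mul_rpow hs.1.le hE.le, Real.mul_rpow h1.le hE.le,
    Real.mul_rpow hE.le hE.le, Real.mul_rpow hs.1.le h1.le, ← h2]
  ring

theorem betaWeight_nonneg {r : ℝ} (hr : r ∈ Icc (0 : ℝ) 1) : 0 ≤ betaWeight P r :=
  Real.rpow_nonneg (mul_nonneg hr.1 (sub_nonneg.2 hr.2)) _

theorem lintegral_betaMeasure {f : ℝ → ℝ≥0∞} (hf : Measurable f) :
    ∫⁻ r, f r ∂betaMeasure P = ∫⁻ r in Ioo (0 : ℝ) 1, ENNReal.ofReal (betaWeight P r) * f r := by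
  rw [betaMeasure, lintegral_withDensity_eq_lintegral_mul _ (by fun_prop) hf,
    Measure.restrict_congr_set Ioo_ae_eq_Icc.symm]
  rfl

theorem lintegral_int_pair {Φ : ℝ × ℝ → ℝ≥0∞} (hΦ : Measurable Φ) :
    ∫⁻ x, Φ x ∂((intMeasure P S).prod (intMeasure P S)) =
      ∫⁻ E in Ioi (0 : ℝ), ENNReal.ofReal (E * ((E * E) ^ (P.δ / 2 - 1) * expInt P S E)) *
        ∫⁻ s, Φ (s * E, (1 - s) * E) ∂betaMeasure P := by
  rw [intMeasure, prod_withDensity (by fun_prop) (by fun_prop),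
    lintegral_withDensity_eq_lintegral_mul _ (by fun_prop) hΦ, lintegral_Ioi_pair (by fun_prop)]
  refine setLIntegral_congr_fun measurableSet_Ioi fun E hE => ?_
  rw [lintegral_betaMeasure _ (by fun_prop), ENNReal.ofReal_mul (le_of_lt hE), mul_assoc]
  congr 1
  rw [← lintegral_const_mul _ (by fun_prop)]
  refine setLIntegral_congr_fun measurableSet_Ioo fun s hs => ?_
  simp only [Pi.mul_apply]
  rw [← ENNReal.ofReal_mul (intWeight_pos P S (mul_pos hs.1 hE)).le,
    intWeight_mul_intWeight P S hE hs,
    ENNReal.ofReal_mul (betaWeight_nonneg P ⟨hs.1.le, hs.2.le⟩)]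
  ring

/-- A collision keeps `E` and replaces the fraction `s` by an independent `r`. Under two Gamma laws
`s` already has the Beta law of `r` and is independent of `E`, so only the mass of the Beta law
appears. -/
theorem lintegral_int_collInt {Φ : ℝ × ℝ → ℝ≥0∞} (hΦ : Measurable Φ) :
    ∫⁻ p, Φ (collInt p) ∂(((intMeasure P S).prod (intMeasure P S)).prod (betaMeasure P)) =
      betaMeasure P univ * ∫⁻ x, Φ x ∂((intMeasure P S).prod (intMeasure P S)) := by
  rw [lintegral_prod _ (by fun_prop), lintegral_int_pair P S hΦ, lintegral_int_pair P S
    (Measurable.lintegral_prod_right' (f := fun p => Φ (collInt p)) (by fun_prop)),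
    ← lintegral_const_mul]
  · refine lintegral_congr fun E => ?_
    have h : ∀ s : ℝ, s * E + (1 - s) * E = E := fun s => by ring
    simp only [collInt, h, lintegral_const]
    ring
  · refine Measurable.mul (by fun_prop) (Measurable.lintegral_prod_right'
      (f := fun p : ℝ × ℝ => Φ (p.2 * p.1, (1 - p.2) * p.1)) (by fun_prop))

theorem map_collInt : (((intMeasure P S).prod (intMeasure P S)).prod (betaMeasure P)).map collInt =
    betaMeasure P univ • (intMeasure P S).prod (intMeasure P S) := by
  refine Measure.ext_of_lintegral _ fun Φ hΦ => ?_
  rw [lintegral_map hΦ (by fun_prop), lintegral_int_collInt P S hΦ, lintegral_smul_measure,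
    smul_eq_mul]

theorem betaWeight_le_one {r : ℝ} (hr : r ∈ Icc (0 : ℝ) 1) : betaWeight P r ≤ 1 := by
  have h1 : 0 ≤ 1 - r := sub_nonneg.2 hr.2
  -- `δ ≥ 2` makes the exponent nonnegative, so the Beta weight is bounded.
  refine Real.rpow_le_one (mul_nonneg hr.1 h1) ?_ (by linarith [P.two_le_δ])
  nlinarith [hr.1, hr.2]

instance : IsFiniteMeasure (betaMeasure P) := by
  constructor
  rw [betaMeasure, withDensity_apply _ MeasurableSet.univ, Measure.restrict_univ]
  refine lt_of_le_of_lt (setLIntegral_mono (g := fun _ => 1) (by fun_prop) fun r hr => ?_)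
    (by simp)
  simpa using betaWeight_le_one P hr

/-- The distribution of all the variables of a collision. -/
def totalMeasure : Measure (((Vel × Vel) × Metric.sphere (0 : Vel) 1) × ((ℝ × ℝ) × ℝ)) :=
  ((velPairMeasure P S).prod sphereMeasure).prod
    (((intMeasure P S).prod (intMeasure P S)).prod (betaMeasure P))

/-- The distribution of the states of two colliding molecules. -/
def pairMeasure : Measure ((Vel × Vel) × (ℝ × ℝ)) :=
  (velPairMeasure P S).prod ((intMeasure P S).prod (intMeasure P S))

instance : SFinite (pairMeasure P S) := by unfold pairMeasure; infer_instance
instance : SFinite (totalMeasure P S) := by unfold totalMeasure; infer_instance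

/-- The states before a collision. -/
def pre (p : ((Vel × Vel) × Metric.sphere (0 : Vel) 1) × ((ℝ × ℝ) × ℝ)) :
    (Vel × Vel) × (ℝ × ℝ) := (p.1.1, p.2.1)

/-- The states after a collision. -/
def post (p : ((Vel × Vel) × Metric.sphere (0 : Vel) 1) × ((ℝ × ℝ) × ℝ)) :
    (Vel × Vel) × (ℝ × ℝ) := (collVel p.1, collInt p.2)

@[fun_prop]
theorem measurable_pre : Measurable pre := by unfold pre; fun_prop

@[fun_prop]
theorem measurable_post : Measurable post := by unfold post; fun_prop

/-- The total mass of the scattering parameters. -/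
def collMass : ℝ≥0∞ := sphereMeasure univ * betaMeasure P univ

theorem collMass_ne_top : collMass P ≠ ∞ :=
  ENNReal.mul_ne_top (measure_ne_top _ _) (measure_ne_top _ _)

theorem map_pre : (totalMeasure P S).map pre = collMass P • pairMeasure P S := by
  have h : pre = Prod.map Prod.fst Prod.fst := rfl
  rw [h, totalMeasure, ← Measure.map_prod_map _ _ measurable_fst measurable_fst,
    Measure.map_fst_prod, Measure.map_fst_prod, Measure.prod_smul_left, Measure.prod_smul_right,
    smul_smul, collMass, pairMeasure]

/-- Together with `map_pre` this is the equidistribution of the pair before and after a collision.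
It is the only form of reversibility that the dissipation argument needs. -/
theorem map_post : (totalMeasure P S).map post = collMass P • pairMeasure P S := by
  have h : post = Prod.map collVel collInt := rfl
  rw [h, totalMeasure, ← Measure.map_prod_map _ _ (by fun_prop) (by fun_prop),
    map_collVel, map_collInt, Measure.prod_smul_left, Measure.prod_smul_right,
    smul_smul, collMass, pairMeasure]

end Distributions

/-! ### Finite moments, and the domain of the linearized operator as a product `L²` space. -/

section Integrability

variable (P : Model) (S : FluidState)

theorem integrableOn_rpow_mul_expInt {s : ℝ} (hs : -1 < s) :
    IntegrableOn (fun I => I ^ s * expInt P S I) (Ioi 0) := by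
  have h := integrableOn_rpow_mul_exp_neg_mul_rpow hs one_pos
    (inv_pos.2 (mul_pos P.kB_pos S.Tint_pos))
  refine h.congr_fun (fun I _ => ?_) measurableSet_Ioi
  simp only [expInt, Real.rpow_one, div_eq_inv_mul, neg_mul]

theorem integrableOn_pow_mul_expTr (k : ℕ) :
    IntegrableOn (fun c => c ^ k * expTr P S c) (Ioi 0) := by
  have hb : 0 < P.m / (2 * P.kB * S.Ttr) :=
    div_pos P.m_pos (mul_pos (mul_pos two_pos P.kB_pos) S.Ttr_pos)
  have h := integrableOn_rpow_mul_exp_neg_mul_sq hb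
    (lt_of_lt_of_le (by norm_num) (Nat.cast_nonneg (α := ℝ) k))
  refine h.congr_fun (fun c _ => ?_) measurableSet_Ioi
  simp only [expTr, Real.rpow_natCast, neg_mul, mul_div_right_comm]

theorem integrable_intMeasure_iff {f : ℝ → ℝ} :
    Integrable f (intMeasure P S) ↔ IntegrableOn (fun I => intWeight P S I * f I) (Ioi 0) := by
  rw [intMeasure, integrable_withDensity_iff_integrable_smul' (by fun_prop) (by simp)]
  refine integrable_congr ((ae_restrict_mem measurableSet_Ioi).mono fun I hI => ?_)
  simp only [smul_eq_mul]
  rw [ENNReal.toReal_ofReal (intWeight_pos P S hI).le]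

theorem integral_intMeasure (f : ℝ → ℝ) :
    ∫ I, f I ∂intMeasure P S = ∫ I in Ioi (0 : ℝ), intWeight P S I * f I := by
  rw [intMeasure, integral_withDensity_eq_integral_toReal_smul (by fun_prop) (by simp)]
  refine setIntegral_congr_fun measurableSet_Ioi fun I hI => ?_
  simp only [smul_eq_mul]
  rw [ENNReal.toReal_ofReal (intWeight_pos P S hI).le]

theorem integrable_pow_intMeasure (k : ℕ) : Integrable (fun I => I ^ k) (intMeasure P S) := by
  rw [integrable_intMeasure_iff]
  refine (integrableOn_rpow_mul_expInt P S (s := P.δ / 2 - 1 + k) ?_).congr_fun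
    (fun I hI => ?_) measurableSet_Ioi
  · have := P.two_le_δ
    have := Nat.cast_nonneg (α := ℝ) k
    linarith
  · simp only [intWeight]
    rw [Real.rpow_add_natCast (ne_of_gt hI)]
    ring

instance : IsFiniteMeasure (intMeasure P S) := by
  have h := integrable_pow_intMeasure P S 0
  simpa [integrable_const_iff] using h

theorem memLp_id_intMeasure : MemLp (fun I : ℝ => I) 2 (intMeasure P S) :=
  (memLp_two_iff_integrable_sq (by fun_prop)).2 (integrable_pow_intMeasure P S 2)

theorem integrable_norm_pow_mul_expTr (k : ℕ) :
    Integrable (fun ξ : Vel => ‖ξ - S.u‖ ^ k * expTr P S ‖ξ - S.u‖) := by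
  have h : Integrable (fun c : Vel => ‖c‖ ^ k * expTr P S ‖c‖) := by
    rw [integrable_fun_norm_addHaar volume (f := fun c => c ^ k * expTr P S c)]
    refine (integrableOn_pow_mul_expTr P S (k + 2)).congr_fun (fun c _ => ?_) measurableSet_Ioi
    simp [pow_add]
    ring
  exact h.comp_sub_right S.u

theorem integrable_velMeasure_iff {f : Vel → ℝ} :
    Integrable f (velMeasure P S) ↔ Integrable (fun ξ => expTr P S ‖ξ - S.u‖ * f ξ) := by
  rw [velMeasure, integrable_withDensity_iff_integrable_smul' (by fun_prop) (by simp)]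
  simp only [smul_eq_mul, ENNReal.toReal_ofReal (expTr_pos P S _).le]

theorem integrable_norm_pow_velMeasure (k : ℕ) :
    Integrable (fun ξ : Vel => ‖ξ - S.u‖ ^ k) (velMeasure P S) := by
  rw [integrable_velMeasure_iff]
  simpa only [mul_comm] using integrable_norm_pow_mul_expTr P S k

instance : IsFiniteMeasure (velMeasure P S) := by
  have h := integrable_norm_pow_velMeasure P S 0
  simpa [integrable_const_iff] using h

/-- The velocity part of the weight in the domain of the linearized operator. -/
def velDomMeasure : Measure Vel :=
  volume.withDensity fun ξ => ENNReal.ofReal (expTr P S ‖ξ - S.u‖ * (1 + ‖ξ‖) ^ P.β)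

instance : SFinite (velDomMeasure P S) := by unfold velDomMeasure; infer_instance

theorem one_le_one_add_norm_rpow (ξ : Vel) : 1 ≤ (1 + ‖ξ‖) ^ P.β :=
  Real.one_le_rpow (by linarith [norm_nonneg ξ]) P.β_nonneg

instance : IsFiniteMeasure (velDomMeasure P S) := by
  have h0 : Integrable (fun ξ : Vel => (1 + ‖S.u‖) * (‖ξ - S.u‖ ^ 0 * expTr P S ‖ξ - S.u‖)
      + ‖ξ - S.u‖ ^ 1 * expTr P S ‖ξ - S.u‖) :=
    ((integrable_norm_pow_mul_expTr P S 0).const_mul _).add (integrable_norm_pow_mul_expTr P S 1)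
  have h : Integrable (fun ξ : Vel => expTr P S ‖ξ - S.u‖ * (1 + ‖ξ‖) ^ P.β) := by
    refine h0.mono' (by fun_prop) (Filter.Eventually.of_forall fun ξ => ?_)
    have h1 : 1 ≤ 1 + ‖ξ‖ := by linarith [norm_nonneg ξ]
    -- Here `β ≤ 1` bounds the weight by an affine function of `|ξ|`, whose Gaussian moment is
    -- finite.
    have h2 : (1 + ‖ξ‖) ^ P.β ≤ 1 + ‖ξ‖ := by
      simpa using Real.rpow_le_rpow_of_exponent_le h1 P.β_le_one
    have h3 : ‖ξ‖ ≤ ‖ξ - S.u‖ + ‖S.u‖ := by simpa using norm_add_le (ξ - S.u) S.u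
    have h4 := expTr_pos P S ‖ξ - S.u‖
    rw [Real.norm_of_nonneg (by positivity)]
    nlinarith
  constructor
  rw [velDomMeasure, withDensity_apply _ MeasurableSet.univ, Measure.restrict_univ]
  exact h.lintegral_lt_top

theorem velMeasure_le_velDomMeasure : velMeasure P S ≤ velDomMeasure P S := by
  refine withDensity_mono (Filter.Eventually.of_forall fun ξ => ENNReal.ofReal_le_ofReal ?_)
  exact le_mul_of_one_le_right (expTr_pos P S _).le (one_le_one_add_norm_rpow P ξ)

/-- From `|ξ - ξ_*| ≤ (1 + |ξ|)(1 + |ξ_*|)`. The weight in the domain of `L_r` thus controls the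
collision frequency, and functions in the domain are square integrable under the pair law. -/
theorem velPairMeasure_le : velPairMeasure P S ≤ (velDomMeasure P S).prod (velDomMeasure P S) := by
  rw [velDomMeasure, prod_withDensity (by fun_prop) (by fun_prop)]
  refine withDensity_mono (Filter.Eventually.of_forall fun v => ?_)
  simp only [velPairDensity]
  have h1 := expTr_pos P S ‖v.1 - S.u‖
  have h2 := expTr_pos P S ‖v.2 - S.u‖
  rw [← ENNReal.ofReal_mul (by positivity)]
  refine ENNReal.ofReal_le_ofReal ?_
  have h3 : ‖v.1 - v.2‖ ^ P.β ≤ (1 + ‖v.1‖) ^ P.β * (1 + ‖v.2‖) ^ P.β := by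
    rw [← Real.mul_rpow (by positivity) (by positivity)]
    refine Real.rpow_le_rpow (norm_nonneg _) ?_ P.β_nonneg
    nlinarith [norm_sub_le v.1 v.2, norm_nonneg v.1, norm_nonneg v.2]
  calc _ ≤ expTr P S ‖v.1 - S.u‖ * expTr P S ‖v.2 - S.u‖ *
        ((1 + ‖v.1‖) ^ P.β * (1 + ‖v.2‖) ^ P.β) := by gcongr
    _ = _ := by ring

instance : IsFiniteMeasure (velPairMeasure P S) :=
  isFiniteMeasure_of_le _ (velPairMeasure_le P S)

instance : IsFiniteMeasure (pairMeasure P S) := by unfold pairMeasure; infer_instance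
instance : IsFiniteMeasure (totalMeasure P S) := by unfold totalMeasure; infer_instance

/-- The weight in the domain of the linearized operator. -/
def domMeasure : Measure (Vel × ℝ) := (velDomMeasure P S).prod (intMeasure P S)

instance : IsFiniteMeasure (domMeasure P S) := by unfold domMeasure; infer_instance

/-- The normalization constant of the equilibrium distribution. -/
def Mconst : ℝ :=
  (S.ρ / P.m) / ((2 * Real.pi * P.kB * S.Ttr / P.m) ^ (3 / 2 : ℝ) * (P.kB * S.Tint) ^ (P.δ / 2)
    * Real.Gamma (P.δ / 2))

theorem half_δ_pos : 0 < P.δ / 2 := by linarith [P.two_le_δ]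

theorem Mconst_pos : 0 < Mconst P S := by
  have := P.m_pos
  have := P.kB_pos
  have := S.ρ_pos
  have := S.Ttr_pos
  have := S.Tint_pos
  have := Real.Gamma_pos_of_pos (half_δ_pos P)
  unfold Mconst
  positivity

theorem Mr_eq (ξ : Vel) (I : ℝ) :
    Mr P S ξ I = Mconst P S * (expTr P S ‖ξ - S.u‖ * intWeight P S I) := by
  simp only [Mr, Mconst, expTr, intWeight, expInt, sub_eq_add_neg, Real.exp_add]
  ring

variable {P S}

/-- For `α = 0` the weight of the domain factors into a velocity part and an energy part, up to the
normalization of the equilibrium; this opens the way to Fubini in `I` alone. -/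
theorem InDomain.memLp_domMeasure (hα : P.α = 0) {h : Vel → ℝ → ℝ} (hh : InDomain P S h) :
    MemLp (Function.uncurry h) 2 (domMeasure P S) := by
  have e : (phaseMeasure.withDensity fun z =>
      ENNReal.ofReal ((1 + ‖z.1‖) ^ P.β * (1 + z.2) ^ P.α * Mr P S z.1 z.2)) =
      ENNReal.ofReal (Mconst P S) • domMeasure P S := by
    rw [domMeasure, velDomMeasure, intMeasure, prod_withDensity (by fun_prop) (by fun_prop),
      ← withDensity_smul _ (by fun_prop)]
    refine congrArg _ (funext fun z => ?_)
    have h1 := expTr_pos P S ‖z.1 - S.u‖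
    have h2 := one_le_one_add_norm_rpow P z.1
    rw [Pi.smul_apply, smul_eq_mul, ← ENNReal.ofReal_mul (by positivity),
      ← ENNReal.ofReal_mul (Mconst_pos P S).le, Mr_eq, hα, Real.rpow_zero]
    congr 1
    ring
  rw [InDomain, e] at hh
  refine (hh.smul_measure (c := (ENNReal.ofReal (Mconst P S))⁻¹) ?_).mono_measure ?_
  · simpa using Mconst_pos P S
  · rw [smul_smul, ENNReal.inv_mul_cancel (by simpa using Mconst_pos P S) (by simp), one_smul]

end Integrability

/-! ### Square integrability of collision increments, and vanishing dissipation. -/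

section Dissipation

variable (P : Model) (S : FluidState)

theorem memLp_comp_of_map_eq_smul {α β : Type*} {mα : MeasurableSpace α} {mβ : MeasurableSpace β}
    {μ : Measure α} {ν : Measure β} {f : α → β} {c : ℝ≥0∞} (hf : Measurable f) (hc : c ≠ ∞)
    (hmap : μ.map f = c • ν) {g : β → ℝ} {p : ℝ≥0∞} (hg : MemLp g p ν) :
    MemLp (fun x => g (f x)) p μ := by
  have h := hg.smul_measure hc
  rw [← hmap] at h
  exact h.comp_of_map hf.aemeasurable

theorem integral_comp_of_map_eq_smul {α β : Type*} {mα : MeasurableSpace α}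
    {mβ : MeasurableSpace β} {μ : Measure α} {ν : Measure β} {f : α → β} {c : ℝ≥0∞}
    (hf : Measurable f) (hmap : μ.map f = c • ν) {g : β → ℝ}
    (hg : AEStronglyMeasurable g ν) : ∫ x, g (f x) ∂μ = c.toReal * ∫ y, g y ∂ν := by
  have h : AEStronglyMeasurable g (μ.map f) := by
    rw [hmap]
    exact hg.smul_measure c
  rw [← integral_map hf.aemeasurable h, hmap, integral_smul_measure, smul_eq_mul]

/-- The state of the first molecule of a pair. -/
def fstState (x : (Vel × Vel) × (ℝ × ℝ)) : Vel × ℝ := (x.1.1, x.2.1)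

/-- The state of the second molecule of a pair. -/
def sndState (x : (Vel × Vel) × (ℝ × ℝ)) : Vel × ℝ := (x.1.2, x.2.2)

@[fun_prop]
theorem measurable_fstState : Measurable fstState := by unfold fstState; fun_prop

@[fun_prop]
theorem measurable_sndState : Measurable sndState := by unfold sndState; fun_prop

theorem pairMeasure_le : pairMeasure P S ≤
    ((velDomMeasure P S).prod (velDomMeasure P S)).prod
      ((intMeasure P S).prod (intMeasure P S)) :=
  Measure.prod_mono (velPairMeasure_le P S) le_rfl

variable {P S}

theorem memLp_fstState {h : Vel × ℝ → ℝ} (hh : MemLp h 2 (domMeasure P S)) :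
    MemLp (fun x => h (fstState x)) 2 (pairMeasure P S) := by
  refine MemLp.mono_measure (pairMeasure_le P S) (memLp_comp_of_map_eq_smul
    (c := velDomMeasure P S univ * intMeasure P S univ) (by fun_prop)
    (ENNReal.mul_ne_top (measure_ne_top _ _) (measure_ne_top _ _)) ?_ hh)
  have e : fstState = Prod.map Prod.fst Prod.fst := rfl
  rw [e, ← Measure.map_prod_map _ _ measurable_fst measurable_fst, Measure.map_fst_prod,
    Measure.map_fst_prod, Measure.prod_smul_left, Measure.prod_smul_right, smul_smul, domMeasure]

theorem memLp_sndState {h : Vel × ℝ → ℝ} (hh : MemLp h 2 (domMeasure P S)) :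
    MemLp (fun x => h (sndState x)) 2 (pairMeasure P S) := by
  refine MemLp.mono_measure (pairMeasure_le P S) (memLp_comp_of_map_eq_smul
    (c := velDomMeasure P S univ * intMeasure P S univ) (by fun_prop)
    (ENNReal.mul_ne_top (measure_ne_top _ _) (measure_ne_top _ _)) ?_ hh)
  have e : sndState = Prod.map Prod.snd Prod.snd := rfl
  rw [e, ← Measure.map_prod_map _ _ measurable_snd measurable_snd, Measure.map_snd_prod,
    Measure.map_snd_prod, Measure.prod_smul_left, Measure.prod_smul_right, smul_smul, domMeasure]

/-- The sum of the values of `h` at the states of a pair. -/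
def pairSum (h : Vel × ℝ → ℝ) (x : (Vel × Vel) × (ℝ × ℝ)) : ℝ := h (fstState x) + h (sndState x)

theorem memLp_pairSum {h : Vel × ℝ → ℝ} (hh : MemLp h 2 (domMeasure P S)) :
    MemLp (pairSum h) 2 (pairMeasure P S) := (memLp_fstState hh).add (memLp_sndState hh)

theorem memLp_pre {H : (Vel × Vel) × (ℝ × ℝ) → ℝ} (hH : MemLp H 2 (pairMeasure P S)) :
    MemLp (fun p => H (pre p)) 2 (totalMeasure P S) :=
  memLp_comp_of_map_eq_smul (by fun_prop) (collMass_ne_top P) (map_pre P S) hH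

theorem memLp_post {H : (Vel × Vel) × (ℝ × ℝ) → ℝ} (hH : MemLp H 2 (pairMeasure P S)) :
    MemLp (fun p => H (post p)) 2 (totalMeasure P S) :=
  memLp_comp_of_map_eq_smul (by fun_prop) (collMass_ne_top P) (map_post P S) hH

/-- The increment of `h` in a collision. -/
def defect (h : Vel × ℝ → ℝ) (p : ((Vel × Vel) × Metric.sphere (0 : Vel) 1) × ((ℝ × ℝ) × ℝ)) :
    ℝ := pairSum h (pre p) - pairSum h (post p)

theorem memLp_defect {h : Vel × ℝ → ℝ} (hh : MemLp h 2 (domMeasure P S)) :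
    MemLp (defect h) 2 (totalMeasure P S) :=
  (memLp_pre (memLp_pairSum hh)).sub (memLp_post (memLp_pairSum hh))

theorem integrable_mul_defect {ψ h : Vel × ℝ → ℝ} (hψ : MemLp ψ 2 (domMeasure P S))
    (hh : MemLp h 2 (domMeasure P S)) :
    Integrable (fun p => ψ (fstState (pre p)) * defect h p) (totalMeasure P S) :=
  (memLp_pre (memLp_fstState hψ)).integrable_mul (memLp_defect hh)

theorem integrable_mul_defect' {ψ h : Vel × ℝ → ℝ} (hψ : MemLp ψ 2 (domMeasure P S))
    (hh : MemLp h 2 (domMeasure P S)) :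
    Integrable (fun p => ψ (sndState (pre p)) * defect h p) (totalMeasure P S) :=
  (memLp_pre (memLp_sndState hψ)).integrable_mul (memLp_defect hh)

/-- The exchange of the two molecules. -/
def exchange (p : ((Vel × Vel) × Metric.sphere (0 : Vel) 1) × ((ℝ × ℝ) × ℝ)) :
    ((Vel × Vel) × Metric.sphere (0 : Vel) 1) × ((ℝ × ℝ) × ℝ) :=
  ((p.1.1.swap, p.1.2), (p.2.1.swap, p.2.2))

variable (P S) in
theorem measurePreserving_swap_velPair :
    MeasurePreserving Prod.swap (velPairMeasure P S) (velPairMeasure P S) := by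
  refine ⟨measurable_swap, Measure.ext_of_lintegral _ fun Φ hΦ => ?_⟩
  rw [lintegral_map hΦ measurable_swap, velPairMeasure,
    lintegral_withDensity_eq_lintegral_mul _ (by fun_prop) (by fun_prop),
    lintegral_withDensity_eq_lintegral_mul _ (by fun_prop) (by fun_prop),
    ← (Measure.measurePreserving_swap (μ := (volume : Measure Vel))
      (ν := (volume : Measure Vel))).lintegral_comp (by fun_prop)]
  refine lintegral_congr fun v => ?_
  simp only [Pi.mul_apply, velPairDensity, Prod.fst_swap, Prod.snd_swap, norm_sub_rev v.2 v.1]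
  rw [mul_comm (expTr P S ‖v.2 - S.u‖), Prod.swap_swap]

variable (P S) in
theorem measurePreserving_exchange :
    MeasurePreserving exchange (totalMeasure P S) (totalMeasure P S) :=
  ((measurePreserving_swap_velPair P S).prod (MeasurePreserving.id _)).prod
    (Measure.measurePreserving_swap.prod (MeasurePreserving.id _))

/-- The outcome depends on the pair only through `ξ + ξ_*`, `|ξ - ξ_*|` and `I + I_*`, so `σ` and
`r` can be kept fixed under the exchange. -/
theorem post_exchange (p) : post (exchange p) = post p := by
  simp only [post, exchange, collVel, collInt, postVel, Prod.fst_swap, Prod.snd_swap,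
    add_comm p.1.1.2, norm_sub_rev p.1.1.2, add_comm p.2.1.2]

theorem defect_exchange (h : Vel × ℝ → ℝ) (p) : defect h (exchange p) = defect h p := by
  rw [defect, defect, post_exchange]
  simp only [pairSum, pre, exchange, fstState, sndState, Prod.fst_swap, Prod.snd_swap]
  ring

theorem measurable_exchange : Measurable exchange := by unfold exchange; fun_prop

theorem exchange_exchange (p) : exchange (exchange p) = p := rfl

theorem integral_exchange (ψ h : Vel × ℝ → ℝ) :
    ∫ p, ψ (sndState (pre p)) * defect h p ∂totalMeasure P S =
      ∫ p, ψ (fstState (pre p)) * defect h p ∂totalMeasure P S := by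
  let e : (((Vel × Vel) × Metric.sphere (0 : Vel) 1) × ((ℝ × ℝ) × ℝ)) ≃ᵐ
      (((Vel × Vel) × Metric.sphere (0 : Vel) 1) × ((ℝ × ℝ) × ℝ)) :=
    { toFun := exchange, invFun := exchange, left_inv := exchange_exchange,
      right_inv := exchange_exchange, measurable_toFun := measurable_exchange,
      measurable_invFun := measurable_exchange }
  have h1 := MeasurePreserving.integral_comp' (f := e) (measurePreserving_exchange P S)
    (fun p => ψ (fstState (pre p)) * defect h p)
  rw [← h1]
  refine integral_congr_ae (Filter.Eventually.of_forall fun p => ?_)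
  change _ = ψ (fstState (pre (exchange p))) * defect h (exchange p)
  rw [defect_exchange]
  rfl

/-- A function without dissipation is invariant in collisions. -/
theorem defect_ae_eq_zero {h : Vel × ℝ → ℝ} (hh : MemLp h 2 (domMeasure P S))
    (h0 : ∫ p, h (fstState (pre p)) * defect h p ∂totalMeasure P S = 0) :
    ∀ᵐ p ∂totalMeasure P S, defect h p = 0 := by
  have hH := memLp_pairSum hh
  have hX := (memLp_pre hH).integrable_sq
  have hY := (memLp_post hH).integrable_sq
  have hsq : AEStronglyMeasurable (fun x => pairSum h x ^ 2) (pairMeasure P S) :=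
    hH.aestronglyMeasurable.pow 2
  -- Equidistribution of the pairs before and after the collision.
  have e1 : ∫ p, pairSum h (pre p) ^ 2 ∂totalMeasure P S =
      ∫ p, pairSum h (post p) ^ 2 ∂totalMeasure P S := by
    rw [integral_comp_of_map_eq_smul (g := fun x => pairSum h x ^ 2) (by fun_prop)
      (map_pre P S) hsq, integral_comp_of_map_eq_smul (g := fun x => pairSum h x ^ 2)
      (by fun_prop) (map_post P S) hsq]
  have h1 := integral_exchange (P := P) (S := S) h h
  rw [h0] at h1
  have i1 := integrable_mul_defect hh hh
  have i2 := integrable_mul_defect' hh hh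
  have e2 : ∫ p, defect h p ^ 2 ∂totalMeasure P S = 0 := by
    -- The identity `(X - Y)² = 2 X (X - Y) + (Y² - X²)`, with `X` and `Y` the sums before and
    -- after. The last bracket integrates to zero, and the two molecules contribute equally to the
    -- first term.
    have : ∀ p, defect h p ^ 2 = 2 * (h (fstState (pre p)) * defect h p)
        + 2 * (h (sndState (pre p)) * defect h p)
        + (pairSum h (post p) ^ 2 - pairSum h (pre p) ^ 2) := by
      intro p
      simp only [defect, pairSum]
      ring
    simp_rw [this]
    have h4 := integral_add ((i1.const_mul 2).add (i2.const_mul 2)) (hY.sub hX)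
    simp only [Pi.add_apply, Pi.sub_apply] at h4
    rw [h4, integral_add (i1.const_mul 2) (i2.const_mul 2), integral_sub hY hX, integral_const_mul,
      integral_const_mul, h0, h1, e1]
    ring
  have h3 := (integral_eq_zero_iff_of_nonneg (fun p => sq_nonneg (defect h p))
    (memLp_defect hh).integrable_sq).1 e2
  filter_upwards [h3] with p hp
  exact pow_eq_zero_iff two_ne_zero |>.1 hp

end Dissipation

/-! ### The weak form of `L_r`. -/

section WeakForm

variable (P : Model) (S : FluidState)

theorem measurePreserving_interchange {α β γ δ : Type*} [MeasurableSpace α] [MeasurableSpace β]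
    [MeasurableSpace γ] [MeasurableSpace δ] (a : Measure α) (b : Measure β) (c : Measure γ)
    (d : Measure δ) [SFinite a] [SFinite b] [SFinite c] [SFinite d] :
    MeasurePreserving (fun x : (α × β) × (γ × δ) => ((x.1.1, x.2.1), (x.1.2, x.2.2)))
      ((a.prod b).prod (c.prod d)) ((a.prod c).prod (b.prod d)) := by
  have h1 := measurePreserving_prodAssoc a b (c.prod d)
  have h2 := (MeasurePreserving.id a).prod (measurePreserving_prodAssoc b c d).symm
  have h3 := (MeasurePreserving.id a).prod
    ((Measure.measurePreserving_swap (μ := b) (ν := c)).prod (MeasurePreserving.id d))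
  have h4 := (MeasurePreserving.id a).prod (measurePreserving_prodAssoc c b d)
  have h5 := (measurePreserving_prodAssoc a c (b.prod d)).symm
  exact h5.comp (h4.comp (h3.comp (h2.comp h1)))

/-- The variables of a collision, with the velocities separated from the internal energies. -/
def reorder : ((Vel × ℝ) × (ℝ × Metric.sphere (0 : Vel) 1 × Vel × ℝ)) ≃ᵐ
    (((Vel × Vel) × Metric.sphere (0 : Vel) 1) × ((ℝ × ℝ) × ℝ)) where
  toFun q := (((q.1.1, q.2.2.2.1), q.2.2.1), ((q.1.2, q.2.2.2.2), q.2.1))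
  invFun p := ((p.1.1.1, p.2.1.1), (p.2.2, p.1.2, p.1.1.2, p.2.1.2))
  left_inv _ := rfl
  right_inv _ := rfl
  measurable_toFun := by
    change Measurable fun q : (Vel × ℝ) × (ℝ × Metric.sphere (0 : Vel) 1 × Vel × ℝ) =>
      (((q.1.1, q.2.2.2.1), q.2.2.1), ((q.1.2, q.2.2.2.2), q.2.1))
    fun_prop
  measurable_invFun := by
    change Measurable fun p : ((Vel × Vel) × Metric.sphere (0 : Vel) 1) × ((ℝ × ℝ) × ℝ) =>
      ((p.1.1.1, p.2.1.1), (p.2.2, p.1.2, p.1.1.2, p.2.1.2))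
    fun_prop

/-- Lebesgue measure in all the variables of a collision. -/
def lebTotal : Measure (((Vel × Vel) × Metric.sphere (0 : Vel) 1) × ((ℝ × ℝ) × ℝ)) :=
  (((volume : Measure Vel).prod volume).prod sphereMeasure).prod
    (((volume.restrict (Ioi (0 : ℝ))).prod (volume.restrict (Ioi (0 : ℝ)))).prod
      (volume.restrict (Icc (0 : ℝ) 1)))

instance : SFinite phaseMeasure := by unfold phaseMeasure; infer_instance
instance : SFinite collisionMeasure := by unfold collisionMeasure; infer_instance

theorem measurePreserving_reorder :
    MeasurePreserving reorder (phaseMeasure.prod collisionMeasure) lebTotal := by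
  set R := volume.restrict (Ioi (0 : ℝ)) with hR
  set T := volume.restrict (Icc (0 : ℝ) 1) with hT
  set V := (volume : Measure Vel) with hV
  have : SFinite R := hR ▸ inferInstance
  have : SFinite T := hT ▸ inferInstance
  have : SFinite V := hV ▸ inferInstance
  have h1 : MeasurePreserving _ (T.prod (sphereMeasure.prod (V.prod R))) _ :=
    Measure.measurePreserving_swap
  have h2 := (Measure.measurePreserving_swap (μ := sphereMeasure) (ν := V.prod R)).prod
    (MeasurePreserving.id T)
  have h3 := measurePreserving_prodAssoc (V.prod R) sphereMeasure T
  have h4 := (MeasurePreserving.id (V.prod R)).prod (h3.comp (h2.comp h1))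
  have h5 := (measurePreserving_prodAssoc (V.prod R) (V.prod R) (sphereMeasure.prod T)).symm
  have h6 := (measurePreserving_interchange V R V R).prod
    (MeasurePreserving.id (sphereMeasure.prod T))
  have h7 := measurePreserving_interchange (V.prod V) (R.prod R) sphereMeasure T
  exact h7.comp (h6.comp (h5.comp h4))

/-- The density of `totalMeasure` with respect to Lebesgue measure. -/
def totalDensity (p : ((Vel × Vel) × Metric.sphere (0 : Vel) 1) × ((ℝ × ℝ) × ℝ)) : ℝ≥0∞ :=
  ENNReal.ofReal (velPairDensity P S p.1.1) *
    (ENNReal.ofReal (intWeight P S p.2.1.1) * ENNReal.ofReal (intWeight P S p.2.1.2) *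
      ENNReal.ofReal (betaWeight P p.2.2))

@[fun_prop]
theorem measurable_totalDensity : Measurable (totalDensity P S) := by
  unfold totalDensity; fun_prop

theorem totalMeasure_eq : totalMeasure P S = lebTotal.withDensity (totalDensity P S) := by
  rw [totalMeasure, velPairMeasure, intMeasure, betaMeasure, prod_withDensity_left (by fun_prop),
    prod_withDensity (by fun_prop) (by fun_prop), prod_withDensity (by fun_prop) (by fun_prop),
    prod_withDensity (by fun_prop) (by fun_prop), lebTotal]
  rfl

theorem totalDensity_ne_top (p) : totalDensity P S p < ∞ := by
  unfold totalDensity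
  finiteness

/-- The weight in the collision integral. -/
def gainWeight (ξ : Vel) (z : ℝ × Metric.sphere (0 : Vel) 1 × Vel × ℝ) : ℝ :=
  expTr P S ‖z.2.2.1 - S.u‖ * intWeight P S z.2.2.2 * betaWeight P z.1 * ‖ξ - z.2.2.1‖ ^ P.β

theorem ae_collisionMeasure (ξ : Vel) :
    ∀ᵐ z ∂collisionMeasure, z.1 ∈ Ioo (0 : ℝ) 1 ∧ ξ ≠ z.2.2.1 ∧ 0 < z.2.2.2 := by
  have h1 : ∀ᵐ r ∂volume.restrict (Icc (0 : ℝ) 1), r ∈ Ioo (0 : ℝ) 1 := by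
    rw [Measure.restrict_congr_set Ioo_ae_eq_Icc.symm]
    exact ae_restrict_mem measurableSet_Ioo
  have h2 : ∀ᵐ η : Vel, ξ ≠ η := by
    filter_upwards [compl_mem_ae_iff.2 (measure_singleton ξ)] with η hη h
    exact hη h.symm
  have h3 : ∀ᵐ I ∂volume.restrict (Ioi (0 : ℝ)), 0 < I := ae_restrict_mem measurableSet_Ioi
  unfold collisionMeasure phaseMeasure
  have q1 := Measure.quasiMeasurePreserving_fst (μ := volume.restrict (Icc (0 : ℝ) 1))
    (ν := sphereMeasure.prod ((volume : Measure Vel).prod (volume.restrict (Ioi (0 : ℝ)))))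
  have q2 := Measure.quasiMeasurePreserving_snd (μ := volume.restrict (Icc (0 : ℝ) 1))
    (ν := sphereMeasure.prod ((volume : Measure Vel).prod (volume.restrict (Ioi (0 : ℝ)))))
  have q3 := (Measure.quasiMeasurePreserving_snd (μ := sphereMeasure)
    (ν := (volume : Measure Vel).prod (volume.restrict (Ioi (0 : ℝ))))).comp q2
  filter_upwards [q1.ae h1, (QuasiMeasurePreserving.fst q3).ae h2,
    (QuasiMeasurePreserving.snd q3).ae h3] with z a b c
  exact ⟨a, b, c⟩

variable {P S}

theorem totalDensity_reorder {ξ : Vel} {I : ℝ} (hI : 0 < I)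
    {z : ℝ × Metric.sphere (0 : Vel) 1 × Vel × ℝ} (hr : z.1 ∈ Ioo (0 : ℝ) 1) (hz : 0 < z.2.2.2) :
    (totalDensity P S (reorder ((ξ, I), z))).toReal =
      expTr P S ‖ξ - S.u‖ * intWeight P S I * gainWeight P S ξ z := by
  have h1 := intWeight_pos P S hI
  have h2 := intWeight_pos P S hz
  have h3 := betaWeight_nonneg P (r := z.1) ⟨hr.1.le, hr.2.le⟩
  have h4 := expTr_pos P S ‖ξ - S.u‖
  have h5 := expTr_pos P S ‖z.2.2.1 - S.u‖
  simp only [totalDensity, reorder, MeasurableEquiv.coe_mk, Equiv.coe_fn_mk, velPairDensity]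
  rw [← ENNReal.ofReal_mul h1.le, ← ENNReal.ofReal_mul (by positivity),
    ← ENNReal.ofReal_mul (by positivity), ENNReal.toReal_ofReal (by positivity), gainWeight]
  ring

/-- After division by the powers of the energies, the product of the two equilibria depends on
conserved quantities only and comes out as a common factor of gain and loss. For `α = 0` the powers
of `I + I_*` cancel, leaving `(r (1 - r))^(δ/2-1)`, and `|g| |g|^(β-1) = |g|^β`. -/
theorem collision_integrand (hα : P.α = 0) (h : Vel → ℝ → ℝ) {ξ ξs : Vel} {I Is r : ℝ}
    (σ : Metric.sphere (0 : Vel) 1) (hI : 0 < I) (hIs : 0 < Is) (hr : r ∈ Ioo (0 : ℝ) 1)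
    (hne : ξ ≠ ξs) (f F : Vel → ℝ → ℝ) (hf : f = Mr P S) (hF : F = fun η J => Mr P S η J * h η J)
    (ξ' ξs' : Vel) (I' Is' : ℝ) (hξ' : ξ' = postVel ξ ξs σ) (hξs' : ξs' = postVel ξ ξs (-(σ : Vel)))
    (hI' : I' = r * (I + Is)) (hIs' : Is' = (1 - r) * (I + Is)) :
    ((f ξ' I' * F ξs' Is' + f ξs' Is' * F ξ' I') / (I' * Is') ^ (P.δ / 2 - 1)
        - (f ξ I * F ξs Is + f ξs Is * F ξ I) / (I * Is) ^ (P.δ / 2 - 1))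
      * ((I * Is) ^ (P.δ / 2 - 1) * ‖ξ - ξs‖
        * sigmaR P ‖ξ - ξs‖ I Is I' Is' * (I + Is)) =
    Mr P S ξ I * (Mconst P S * P.Cr) * (gainWeight P S ξ (r, σ, ξs, Is) *
      -defect (Function.uncurry h) (reorder ((ξ, I), (r, σ, ξs, Is)))) := by
  have hE : 0 < I + Is := add_pos hI hIs
  have hr1 : 0 < 1 - r := sub_pos.2 hr.2
  have hI'0 : 0 < I' := hI' ▸ mul_pos hr.1 hE
  have hIs'0 : 0 < Is' := hIs' ▸ mul_pos hr1 hE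
  have hd : defect (Function.uncurry h) (reorder ((ξ, I), (r, σ, ξs, Is))) =
      h ξ I + h ξs Is - (h ξ' I' + h ξs' Is') := by
    rw [hξ', hξs', hI', hIs']; rfl
  have hg : expTr P S ‖ξ' - S.u‖ * expTr P S ‖ξs' - S.u‖ =
      expTr P S ‖ξ - S.u‖ * expTr P S ‖ξs - S.u‖ := by
    have h := norm_sq_postVel_add ξ ξs S.u σ
    simp only [expTr, ← Real.exp_add, hξ', hξs']
    congr 1
    linear_combination (-(P.m / (2 * P.kB * S.Ttr))) * h
  have he : expInt P S I' * expInt P S Is' = expInt P S I * expInt P S Is := by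
    simp only [expInt, ← Real.exp_add, hI', hIs']
    congr 1
    ring
  have hpow : (I' * Is') ^ (P.δ / 2 - 1) / (I + Is) ^ (P.δ - 1) * (I + Is) = betaWeight P r := by
    have e1 : I' * Is' = (r * (1 - r)) * ((I + Is) * (I + Is)) := by rw [hI', hIs']; ring
    have e2 : (I + Is) ^ (P.δ - 1) =
        (I + Is) ^ (P.δ / 2 - 1) * (I + Is) ^ (P.δ / 2 - 1) * (I + Is) := by
      rw [← Real.rpow_add hE, ← Real.rpow_add_one hE.ne']
      congr 1
      ring
    rw [e1, e2, Real.mul_rpow (mul_pos hr.1 hr1).le (mul_pos hE hE).le,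
      Real.mul_rpow hE.le hE.le, betaWeight]
    have := Real.rpow_pos_of_pos hE (P.δ / 2 - 1)
    field_simp
  have hn : 0 < ‖ξ - ξs‖ := norm_pos_iff.2 (sub_ne_zero.2 hne)
  have hnorm : ‖ξ - ξs‖ * ‖ξ - ξs‖ ^ (P.β - 1) = ‖ξ - ξs‖ ^ P.β := by
    rw [Real.rpow_sub_one hn.ne']
    field_simp
  have hp1 := Real.rpow_pos_of_pos hI (P.δ / 2 - 1)
  have hp2 := Real.rpow_pos_of_pos hIs (P.δ / 2 - 1)
  have hp3 := Real.rpow_pos_of_pos hI'0 (P.δ / 2 - 1)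
  have hp4 := Real.rpow_pos_of_pos hIs'0 (P.δ / 2 - 1)
  have k1 : (f ξ' I' * F ξs' Is' + f ξs' Is' * F ξ' I') / (I' * Is') ^ (P.δ / 2 - 1) =
      Mconst P S ^ 2 * (expTr P S ‖ξ' - S.u‖ * expTr P S ‖ξs' - S.u‖) *
        (expInt P S I' * expInt P S Is') * (h ξ' I' + h ξs' Is') := by
    rw [hf, hF, Real.mul_rpow hI'0.le hIs'0.le]
    simp only [Mr_eq, intWeight]
    field_simp
    ring
  have k2 : (f ξ I * F ξs Is + f ξs Is * F ξ I) / (I * Is) ^ (P.δ / 2 - 1) =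
      Mconst P S ^ 2 * (expTr P S ‖ξ - S.u‖ * expTr P S ‖ξs - S.u‖) *
        (expInt P S I * expInt P S Is) * (h ξ I + h ξs Is) := by
    rw [hf, hF, Real.mul_rpow hI.le hIs.le]
    simp only [Mr_eq, intWeight]
    field_simp
    ring
  rw [k1, k2, hg, he, hd, sigmaR, hα, sub_zero, Mr_eq, gainWeight]
  simp only [intWeight]
  rw [← hpow, ← hnorm, Real.mul_rpow hI.le hIs.le]
  ring

/-- The prefactor `-2 M⁻¹` cancels `M/2` and the sign of the increment. No integrability is
required, since only constants are moved through the integral. -/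
theorem Lr_eq (hα : P.α = 0) (h : Vel → ℝ → ℝ) (ξ : Vel) {I : ℝ} (hI : 0 < I) :
    Lr P S h ξ I = Mconst P S * P.Cr * ∫ z, gainWeight P S ξ z *
      defect (Function.uncurry h) (reorder ((ξ, I), z)) ∂collisionMeasure := by
  have hM : 0 < Mr P S ξ I := by
    rw [Mr_eq]
    exact mul_pos (Mconst_pos P S) (mul_pos (expTr_pos P S _) (intWeight_pos P S hI))
  have hQ : Qr P (Mr P S) (fun η J => Mr P S η J * h η J) ξ I = (1 / 2 : ℝ) *
      ∫ z, Mr P S ξ I * (Mconst P S * P.Cr) * (gainWeight P S ξ z *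
        -defect (Function.uncurry h) (reorder ((ξ, I), z))) ∂collisionMeasure := by
    unfold Qr
    congr 1
    refine integral_congr_ae ?_
    filter_upwards [ae_collisionMeasure ξ] with z hz
    exact collision_integrand hα h z.2.1 hI hz.2.2 hz.1 hz.2.1 _ _ rfl rfl _ _ _ _ rfl rfl rfl rfl
  rw [Lr, hQ, integral_const_mul]
  simp only [mul_neg, integral_neg]
  field_simp

/-- The weak form of the linearized operator. -/
theorem integral_mul_defect_eq (hα : P.α = 0) {ψ : Vel × ℝ → ℝ} {h : Vel → ℝ → ℝ}
    (hψ : MemLp ψ 2 (domMeasure P S)) (hh : MemLp (Function.uncurry h) 2 (domMeasure P S)) :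
    Mconst P S * P.Cr *
      ∫ p, ψ (fstState (pre p)) * defect (Function.uncurry h) p ∂totalMeasure P S =
    ∫ z, expTr P S ‖z.1 - S.u‖ * intWeight P S z.2 * (ψ z * Lr P S h z.1 z.2) ∂phaseMeasure := by
  -- The product of two `L²` functions is integrable on the whole collision space, which justifies
  -- integrating first over the collision variables.
  have hi := integrable_mul_defect hψ hh
  rw [totalMeasure_eq, integrable_withDensity_iff_integrable_smul' (by fun_prop)
    (Filter.Eventually.of_forall (totalDensity_ne_top P S)),
    ← measurePreserving_reorder.integrable_comp_emb reorder.measurableEmbedding] at hi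
  simp only [Function.comp_def] at hi
  rw [totalMeasure_eq, integral_withDensity_eq_integral_toReal_smul (by fun_prop)
    (Filter.Eventually.of_forall (totalDensity_ne_top P S)),
    ← measurePreserving_reorder.integral_comp', integral_prod _ hi, ← integral_const_mul]
  have hpos : ∀ᵐ z ∂phaseMeasure, 0 < z.2 :=
    Measure.quasiMeasurePreserving_snd.ae (ae_restrict_mem measurableSet_Ioi)
  refine integral_congr_ae ?_
  filter_upwards [hpos] with z hz
  rw [Lr_eq hα h z.1 hz]
  have : ∫ y, (totalDensity P S (reorder (z, y))).toReal • (ψ (fstState (pre (reorder (z, y)))) *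
        defect (Function.uncurry h) (reorder (z, y))) ∂collisionMeasure =
      ∫ y, (expTr P S ‖z.1 - S.u‖ * intWeight P S z.2 * ψ z) * (gainWeight P S z.1 y *
        defect (Function.uncurry h) (reorder ((z.1, z.2), y))) ∂collisionMeasure := by
    refine integral_congr_ae ?_
    filter_upwards [ae_collisionMeasure z.1] with y hy
    have h1 := totalDensity_reorder (P := P) (S := S) (ξ := z.1) hz hy.1 hy.2.2
    have h2 : fstState (pre (reorder (z, y))) = z := rfl
    simp only [Prod.mk.eta] at h1 ⊢
    rw [h1, h2, smul_eq_mul]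
    ring
  rw [this, integral_const_mul]
  ring

end WeakForm

/-! ### Projection to a profile in the internal energy. -/

section Projection

variable {P : Model} {S : FluidState}

variable (P S) in
theorem volume_ac_velDomMeasure : (volume : Measure Vel) ≪ velDomMeasure P S := by
  refine withDensity_absolutelyContinuous' (by fun_prop) (Filter.Eventually.of_forall fun ξ => ?_)
  have h1 := expTr_pos P S ‖ξ - S.u‖
  have h2 := one_le_one_add_norm_rpow P ξ
  simp only [ne_eq, ENNReal.ofReal_eq_zero, not_le]
  positivity

theorem memLp_section {ψ : Vel × ℝ → ℝ} (hm : Measurable ψ) (hψ : MemLp ψ 2 (domMeasure P S)) :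
    ∀ᵐ ξ ∂velDomMeasure P S, MemLp (fun I => ψ (ξ, I)) 2 (intMeasure P S) := by
  filter_upwards [hψ.integrable_sq.prod_right_ae] with ξ hξ
  exact (memLp_two_iff_integrable_sq
    (hm.comp measurable_prodMk_left).aestronglyMeasurable).2 hξ

variable (P) in
theorem integral_id_betaMeasure :
    ∫ r, r ∂betaMeasure P = (1 / 2 : ℝ) * ∫ _r, (1 : ℝ) ∂betaMeasure P := by
  have hI : ∀ f : ℝ → ℝ, ∫ r, f r ∂betaMeasure P = ∫ r in (0 : ℝ)..1, betaWeight P r * f r := by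
    intro f
    rw [betaMeasure, integral_withDensity_eq_integral_toReal_smul (by fun_prop) (by simp),
      intervalIntegral.integral_of_le zero_le_one, ← integral_Icc_eq_integral_Ioc]
    refine setIntegral_congr_fun measurableSet_Icc fun r hr => ?_
    simp only [smul_eq_mul]
    rw [ENNReal.toReal_ofReal (betaWeight_nonneg P hr)]
  have hint : Integrable (fun r : ℝ => r) (betaMeasure P) := by
    refine Integrable.of_bound (by fun_prop) 1 ?_
    have : ∀ᵐ r ∂volume.restrict (Icc (0 : ℝ) 1), ‖r‖ ≤ 1 :=
      (ae_restrict_mem measurableSet_Icc).mono fun r hr => by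
        rw [Real.norm_of_nonneg hr.1]; exact hr.2
    exact (withDensity_absolutelyContinuous _ _).ae_le this
  -- The Beta weight is symmetric under `r ↦ 1 - r`.
  have h1 : ∫ r, (1 - r) ∂betaMeasure P = ∫ r, r ∂betaMeasure P := by
    have hs := intervalIntegral.integral_comp_sub_left (a := 0) (b := 1)
      (fun r => betaWeight P r * r) (1 : ℝ)
    rw [sub_self, sub_zero] at hs
    rw [hI, hI, ← hs]
    refine intervalIntegral.integral_congr fun r _ => ?_
    simp only [betaWeight, sub_sub_cancel, mul_comm r]
  rw [integral_sub (integrable_const _) hint] at h1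
  linarith

/-- An affine profile in the internal energy is orthogonal to the dissipation of its multiples. -/
theorem integral_mul_defect_eq_zero {ψ : Vel × ℝ → ℝ} {η : Vel → ℝ} {a b : ℝ}
    (hm : Measurable ψ) (hψ : MemLp ψ 2 (domMeasure P S))
    (hη : MemLp (fun z : Vel × ℝ => (a * z.2 + b) * η z.1) 2 (domMeasure P S))
    (h1 : ∀ᵐ ξ ∂velDomMeasure P S, ∫ I, ψ (ξ, I) * (a * I + b) ∂intMeasure P S = 0)
    (h2 : ∀ᵐ ξ ∂velDomMeasure P S,
      (∫ I, ψ (ξ, I) ∂intMeasure P S) * ∫ I, (a * I + b) ∂intMeasure P S = 0) :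
    ∫ p, ψ (fstState (pre p)) * defect (fun z : Vel × ℝ => (a * z.2 + b) * η z.1) p
      ∂totalMeasure P S = 0 := by
  have hi := integrable_mul_defect hψ hη
  rw [totalMeasure] at hi ⊢
  rw [integral_prod _ hi]
  have hq : Measure.QuasiMeasurePreserving (fun v : (Vel × Vel) × Metric.sphere (0 : Vel) 1 =>
      v.1.1) ((velPairMeasure P S).prod sphereMeasure) (velDomMeasure P S) :=
    (Measure.quasiMeasurePreserving_fst.mono_left
      (Measure.absolutelyContinuous_of_le (velPairMeasure_le P S))).comp
      Measure.quasiMeasurePreserving_fst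
  refine integral_eq_zero_of_ae ?_
  filter_upwards [hq.ae (memLp_section hm hψ), hq.ae h1, hq.ae h2] with v hA e1 e2
  set A : ℝ → ℝ := fun I => ψ (v.1.1, I) with hAdef
  have iA : Integrable A (intMeasure P S) := hA.integrable (by norm_num)
  have iAI : Integrable (fun I => A I * I) (intMeasure P S) :=
    hA.integrable_mul (memLp_id_intMeasure P S)
  have i1 : Integrable (fun _ : ℝ => (1 : ℝ)) (intMeasure P S) := integrable_const _
  have iI : Integrable (fun I : ℝ => I) (intMeasure P S) := by
    simpa using integrable_pow_intMeasure P S 1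
  have j1 : Integrable (fun _ : ℝ => (1 : ℝ)) (betaMeasure P) := integrable_const _
  have jr : Integrable (fun r : ℝ => r) (betaMeasure P) := by
    refine Integrable.of_bound (by fun_prop) 1 ?_
    have : ∀ᵐ r ∂volume.restrict (Icc (0 : ℝ) 1), ‖r‖ ≤ 1 :=
      (ae_restrict_mem measurableSet_Icc).mono fun r hr => by
        rw [Real.norm_of_nonneg hr.1]; exact hr.2
    exact (withDensity_absolutelyContinuous _ _).ae_le this
  have key : ∀ {f g k : ℝ → ℝ}, Integrable f (intMeasure P S) → Integrable g (intMeasure P S) →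
      Integrable k (betaMeasure P) → Integrable (fun e : (ℝ × ℝ) × ℝ => f e.1.1 * g e.1.2 * k e.2)
        (((intMeasure P S).prod (intMeasure P S)).prod (betaMeasure P)) ∧
      ∫ e, f e.1.1 * g e.1.2 * k e.2
        ∂(((intMeasure P S).prod (intMeasure P S)).prod (betaMeasure P)) =
      (∫ I, f I ∂intMeasure P S) * (∫ I, g I ∂intMeasure P S) * ∫ r, k r ∂betaMeasure P := by
    intro f g k hf hg hk
    refine ⟨(hf.mul_prod hg).mul_prod hk, ?_⟩
    rw [integral_prod_mul (fun e : ℝ × ℝ => f e.1 * g e.2) k, integral_prod_mul]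
  obtain ⟨u1, v1⟩ := key iAI i1 j1
  obtain ⟨u2, v2⟩ := key iA i1 j1
  obtain ⟨u3, v3⟩ := key iA iI j1
  obtain ⟨u4, v4⟩ := key iAI i1 jr
  obtain ⟨u5, v5⟩ := key iA iI jr
  set x1 := η v.1.1
  set x2 := η v.1.2
  set x3 := η (collVel v).1
  set x4 := η (collVel v).2
  -- With the velocities frozen, the increment is a polynomial in `I`, `I_*`, `r`, each monomial
  -- being a product of functions of one variable; the integral over the energies therefore factors.
  have hF : ∀ e : (ℝ × ℝ) × ℝ, ψ (fstState (pre (v, e))) *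
      defect (fun z : Vel × ℝ => (a * z.2 + b) * η z.1) (v, e) =
      (a * x1 - a * x4) * (A e.1.1 * e.1.1 * 1 * 1) + (b * (x1 + x2 - x3 - x4)) *
        (A e.1.1 * 1 * 1) + (a * x2 - a * x4) * (A e.1.1 * e.1.2 * 1) +
        (a * x4 - a * x3) * (A e.1.1 * e.1.1 * 1 * e.2) +
        (a * x4 - a * x3) * (A e.1.1 * e.1.2 * e.2) := by
    intro e
    simp only [defect, pairSum, pre, post, fstState, sndState, collInt, x1, x2, x3, x4, A]
    ring
  simp_rw [hF]
  have w1 := integral_add (u1.const_mul (a * x1 - a * x4))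
    (u2.const_mul (b * (x1 + x2 - x3 - x4)))
  have w2 := integral_add ((u1.const_mul (a * x1 - a * x4)).add
    (u2.const_mul (b * (x1 + x2 - x3 - x4)))) (u3.const_mul (a * x2 - a * x4))
  have w3 := integral_add (((u1.const_mul (a * x1 - a * x4)).add
    (u2.const_mul (b * (x1 + x2 - x3 - x4)))).add (u3.const_mul (a * x2 - a * x4)))
    (u4.const_mul (a * x4 - a * x3))
  have w4 := integral_add ((((u1.const_mul (a * x1 - a * x4)).add
    (u2.const_mul (b * (x1 + x2 - x3 - x4)))).add (u3.const_mul (a * x2 - a * x4))).add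
    (u4.const_mul (a * x4 - a * x3))) (u5.const_mul (a * x4 - a * x3))
  simp only [Pi.add_apply, integral_const_mul, v1, v2, v3, v4, v5] at w1 w2 w3 w4
  rw [w4, w3, w2, w1, integral_id_betaMeasure]
  have e3 : ∫ I, A I * (a * I + b) ∂intMeasure P S =
      a * ∫ I, A I * I ∂intMeasure P S + b * ∫ I, A I ∂intMeasure P S := by
    rw [← integral_const_mul, ← integral_const_mul, ← integral_add (iAI.const_mul _)
      (iA.const_mul _)]
    exact integral_congr_ae (Filter.Eventually.of_forall fun I => by simp only; ring)
  have e4 : ∫ I, (a * I + b) ∂intMeasure P S =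
      a * ∫ I, I ∂intMeasure P S + b * ∫ _I, (1 : ℝ) ∂intMeasure P S := by
    rw [← integral_const_mul, ← integral_const_mul, ← integral_add (iI.const_mul _)
      (i1.const_mul _)]
    simp only [mul_one]
  rw [e3] at e1
  rw [e4] at e2
  simp only [Pi.zero_apply]
  -- Since `r` has mean `1/2`, each outgoing molecule carries half of the profile of each incoming
  -- one. What remains is a multiple of `∫ ψ χ` and a multiple of `(∫ ψ)(∫ χ)`.
  linear_combination (∫ _I, (1 : ℝ) ∂intMeasure P S) * (∫ _r, (1 : ℝ) ∂betaMeasure P) *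
    (x1 - (1 / 2) * x3 - (1 / 2) * x4) * e1 +
    (∫ _r, (1 : ℝ) ∂betaMeasure P) * (x2 - (1 / 2) * x3 - (1 / 2) * x4) * e2

/-- The coefficient of the projection of `h` to the multiples of the profile `χ`. -/
def profileCoef (P : Model) (S : FluidState) (χ : ℝ → ℝ) (h : Vel → ℝ → ℝ) (ξ : Vel) : ℝ :=
  (∫ I, χ I ^ 2 ∂intMeasure P S)⁻¹ * ∫ I, h ξ I * χ I ∂intMeasure P S

/-- The component of `h` orthogonal to the profile `χ`. -/
def residual (P : Model) (S : FluidState) (χ : ℝ → ℝ) (h : Vel → ℝ → ℝ) (z : Vel × ℝ) : ℝ :=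
  h z.1 z.2 - χ z.2 * profileCoef P S χ h z.1

section Residual

variable {χ : ℝ → ℝ} {h : Vel → ℝ → ℝ}

theorem measurable_profileCoef (hχm : Measurable χ) (hm : Measurable (Function.uncurry h)) :
    Measurable (profileCoef P S χ h) := by
  have : StronglyMeasurable fun ξ => ∫ I, h ξ I * χ I ∂intMeasure P S :=
    StronglyMeasurable.integral_prod_right' (f := fun z : Vel × ℝ => h z.1 z.2 * χ z.2)
      (Measurable.stronglyMeasurable (hm.mul (hχm.comp measurable_snd)))
  exact this.measurable.const_mul _

theorem measurable_residual (hχm : Measurable χ) (hm : Measurable (Function.uncurry h)) :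
    Measurable (residual P S χ h) :=
  hm.sub ((hχm.comp measurable_snd).mul ((measurable_profileCoef hχm hm).comp measurable_fst))

/-- Bessel's inequality in the variable `I`, applied for almost every `ξ`: the squared coefficient
is at most `∫ h² dI / ∫ χ² dI`, which is integrable in `ξ`. -/
theorem memLp_profile (hχm : Measurable χ) (hχ : MemLp χ 2 (intMeasure P S))
    (hκ : 0 < ∫ I, χ I ^ 2 ∂intMeasure P S) (hm : Measurable (Function.uncurry h))
    (hh : MemLp (Function.uncurry h) 2 (domMeasure P S)) :
    MemLp (fun z : Vel × ℝ => χ z.2 * profileCoef P S χ h z.1) 2 (domMeasure P S) := by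
  have hpm := measurable_profileCoef (P := P) (S := S) hχm hm
  have hχ2 := hχ.integrable_sq
  have hsq : Integrable (fun ξ => profileCoef P S χ h ξ ^ 2) (velDomMeasure P S) := by
    refine (hh.integrable_sq.integral_prod_left.const_mul
      (∫ I, χ I ^ 2 ∂intMeasure P S)⁻¹).mono' (by fun_prop) ?_
    filter_upwards [memLp_section hm hh] with ξ hξ
    have i1 := hξ.integrable_sq
    have i2 : Integrable (fun I => h ξ I * χ I) (intMeasure P S) := hξ.integrable_mul hχ
    set c := profileCoef P S χ h ξ with hc
    -- Expanding this square with `∫ h χ = c ∫ χ²` gives `c² ∫ χ² ≤ ∫ h²`.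
    have h0 : 0 ≤ ∫ I, (h ξ I - c * χ I) ^ 2 ∂intMeasure P S :=
      integral_nonneg fun I => sq_nonneg _
    have e : ∀ I, (h ξ I - c * χ I) ^ 2 =
        h ξ I ^ 2 - (2 * c) * (h ξ I * χ I) + c ^ 2 * χ I ^ 2 := fun I => by ring
    have w := integral_add (i1.sub (i2.const_mul (2 * c))) (hχ2.const_mul (c ^ 2))
    have w' := integral_sub i1 (i2.const_mul (2 * c))
    simp only [Function.uncurry_apply_pair, Pi.sub_apply, integral_const_mul] at w w'
    simp_rw [e] at h0
    rw [w, w'] at h0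
    have hcc : ∫ I, h ξ I * χ I ∂intMeasure P S = c * ∫ I, χ I ^ 2 ∂intMeasure P S := by
      rw [hc, profileCoef]
      field_simp
    rw [hcc] at h0
    rw [Real.norm_of_nonneg (sq_nonneg c), ← div_eq_inv_mul, le_div_iff₀ hκ]
    simp only [Function.uncurry_apply_pair]
    linarith
  refine (memLp_two_iff_integrable_sq (by fun_prop)).2 ?_
  have := hsq.mul_prod hχ2
  refine this.congr (Filter.Eventually.of_forall fun z => ?_)
  simp only
  ring

theorem memLp_residual (hχm : Measurable χ) (hχ : MemLp χ 2 (intMeasure P S))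
    (hκ : 0 < ∫ I, χ I ^ 2 ∂intMeasure P S) (hm : Measurable (Function.uncurry h))
    (hh : MemLp (Function.uncurry h) 2 (domMeasure P S)) :
    MemLp (residual P S χ h) 2 (domMeasure P S) :=
  hh.sub (memLp_profile hχm hχ hκ hm hh)

theorem integral_residual_mul (hχ : MemLp χ 2 (intMeasure P S))
    (hκ : 0 < ∫ I, χ I ^ 2 ∂intMeasure P S) (hm : Measurable (Function.uncurry h))
    (hh : MemLp (Function.uncurry h) 2 (domMeasure P S)) :
    ∀ᵐ ξ ∂velDomMeasure P S, ∫ I, residual P S χ h (ξ, I) * χ I ∂intMeasure P S = 0 := by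
  filter_upwards [memLp_section hm hh] with ξ hξ
  have i2 : Integrable (fun I => h ξ I * χ I) (intMeasure P S) := hξ.integrable_mul hχ
  have e : ∀ I, residual P S χ h (ξ, I) * χ I =
      h ξ I * χ I - profileCoef P S χ h ξ * χ I ^ 2 := fun I => by
    simp only [residual]; ring
  simp_rw [e]
  rw [integral_sub i2 (hχ.integrable_sq.const_mul _), integral_const_mul, profileCoef]
  field_simp
  ring

/-- The residual `ψ` is orthogonal to `L_r h`, which is a multiple of `χ` for each `ξ`, and to `L_r`
of the projected part. By linearity `ψ` is orthogonal to `L_r ψ`, so it has no dissipation. `hcase`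
is exactly what makes the multiples of `χ` stable under `L_r`. -/
theorem defect_residual_ae_eq_zero (hα : P.α = 0) {a b : ℝ}
    (hcase : a = 0 ∨ ∫ I, (a * I + b) ∂intMeasure P S = 0)
    (hκ : 0 < ∫ I, (a * I + b) ^ 2 ∂intMeasure P S) (hm : Measurable (Function.uncurry h))
    (hdom : InDomain P S h) {y : Vel → ℝ}
    (hL : ∀ᵐ z ∂phaseMeasure, Lr P S h z.1 z.2 = y z.1 * (a * z.2 + b)) :
    ∀ᵐ p ∂totalMeasure P S, defect (residual P S (fun I => a * I + b) h) p = 0 := by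
  have hh := hdom.memLp_domMeasure hα
  have hχm : Measurable fun I : ℝ => a * I + b := by fun_prop
  have hχ : MemLp (fun I : ℝ => a * I + b) 2 (intMeasure P S) :=
    ((memLp_id_intMeasure P S).const_mul a).add (memLp_const b)
  set ψ := residual P S (fun I => a * I + b) h with hψdef
  have hψm : Measurable ψ := measurable_residual hχm hm
  have hψ : MemLp ψ 2 (domMeasure P S) := memLp_residual hχm hχ hκ hm hh
  have hη := memLp_profile hχm hχ hκ hm hh
  have h1 : ∀ᵐ ξ ∂velDomMeasure P S, ∫ I, ψ (ξ, I) * (a * I + b) ∂intMeasure P S = 0 :=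
    integral_residual_mul hχ hκ hm hh
  have h2 : ∀ᵐ ξ ∂velDomMeasure P S,
      (∫ I, ψ (ξ, I) ∂intMeasure P S) * ∫ I, (a * I + b) ∂intMeasure P S = 0 := by
    -- For a constant profile, orthogonality to `χ` already says that `∫ ψ` times that constant
    -- vanishes; for a centred profile the second factor vanishes.
    rcases hcase with rfl | h0
    · filter_upwards [h1] with ξ hξ
      simp only [zero_mul, zero_add, integral_mul_const] at hξ
      simp only [zero_mul, zero_add, integral_const, smul_eq_mul]
      linear_combination (intMeasure P S).real univ * hξ
    · exact Filter.Eventually.of_forall fun ξ => by rw [h0, mul_zero]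
  have z1 := integral_mul_defect_eq_zero hψm hψ hη h1 h2
  have z2 : ∫ p, ψ (fstState (pre p)) * defect (Function.uncurry h) p ∂totalMeasure P S = 0 := by
    have hw := integral_mul_defect_eq hα hψ hh
    have : ∫ z, expTr P S ‖z.1 - S.u‖ * intWeight P S z.2 * (ψ z * Lr P S h z.1 z.2)
        ∂phaseMeasure = 0 := by
      have hc : ∫ z, expTr P S ‖z.1 - S.u‖ * intWeight P S z.2 * (ψ z * Lr P S h z.1 z.2)
          ∂phaseMeasure = ∫ z, expTr P S ‖z.1 - S.u‖ * y z.1 *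
            (intWeight P S z.2 * (ψ (z.1, z.2) * (a * z.2 + b))) ∂phaseMeasure := by
        refine integral_congr_ae ?_
        filter_upwards [hL] with z hz
        rw [hz]
        ring
      rw [hc]
      -- No integrability of `y` is assumed: if the integrand is not integrable, its integral is
      -- zero by convention, which is the value wanted.
      by_cases hint : Integrable (fun z : Vel × ℝ => expTr P S ‖z.1 - S.u‖ * y z.1 *
            (intWeight P S z.2 * (ψ (z.1, z.2) * (a * z.2 + b)))) phaseMeasure
      · rw [phaseMeasure] at hint ⊢
        rw [integral_prod _ hint]
        refine integral_eq_zero_of_ae ?_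
        filter_upwards [(volume_ac_velDomMeasure P S).ae_le h1] with ξ hξ
        rw [integral_intMeasure] at hξ
        simp only [integral_const_mul, hξ, mul_zero, Pi.zero_apply]
      · exact integral_undef hint
    rw [this] at hw
    exact (mul_eq_zero.1 hw).resolve_left (mul_pos (Mconst_pos P S) P.Cr_pos).ne'
  refine defect_ae_eq_zero hψ ?_
  have e : ∀ p, ψ (fstState (pre p)) * defect ψ p =
      ψ (fstState (pre p)) * defect (Function.uncurry h) p - ψ (fstState (pre p)) *
        defect (fun z : Vel × ℝ => (a * z.2 + b) *
          profileCoef P S (fun I => a * I + b) h z.1) p := by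
    intro p
    rw [← mul_sub]
    congr 1
    simp only [hψdef, defect, pairSum, residual, Function.uncurry]
    ring
  simp_rw [e]
  rw [integral_sub (integrable_mul_defect hψ hh) (integrable_mul_defect hψ hη), z1, z2, sub_zero]

end Residual

end Projection

/-! ### Collision invariants of tensorial and vectorial form. -/

section Invariants

variable {P : Model} {S : FluidState}

variable (P) in
theorem collMass_ne_zero : collMass P ≠ 0 := by
  refine mul_ne_zero ?_ ?_
  · rw [Ne, Measure.measure_univ_eq_zero]
    exact Measure.toSphere_ne_zero _
  · rw [Ne, Measure.measure_univ_eq_zero, betaMeasure, withDensity_eq_zero_iff (by fun_prop)]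
    intro h
    rw [Measure.restrict_congr_set Ioo_ae_eq_Icc.symm] at h
    have h2 : ∀ᵐ r ∂volume.restrict (Ioo (0 : ℝ) 1), False := by
      filter_upwards [h, ae_restrict_mem measurableSet_Ioo] with r hr hr'
      have h3 : 0 < betaWeight P r :=
        Real.rpow_pos_of_pos (mul_pos hr'.1 (sub_pos.2 hr'.2)) _
      simp only [Pi.zero_apply, ENNReal.ofReal_eq_zero] at hr
      linarith
    rw [Filter.eventually_false_iff_eq_bot, ae_eq_bot, Measure.restrict_eq_zero] at h2
    simp at h2

/-- The image of the collision law under `pre` is a nonzero multiple of the pair law, so null sets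
can be pulled back and the parameters `σ`, `r` drop out. -/
theorem ae_pairMeasure_of_pre {Q : (Vel × Vel) × (ℝ × ℝ) → Prop} (hQ : MeasurableSet {x | Q x})
    (h : ∀ᵐ p ∂totalMeasure P S, Q (pre p)) : ∀ᵐ x ∂pairMeasure P S, Q x := by
  have h1 : ∀ᵐ x ∂(totalMeasure P S).map pre, Q x :=
    (ae_map_iff measurable_pre.aemeasurable hQ).2 h
  rw [map_pre] at h1
  exact Measure.absolutelyContinuous_smul (collMass_ne_zero P) |>.ae_le h1

@[fun_prop]
theorem measurable_pairSum {h : Vel × ℝ → ℝ} (hm : Measurable h) : Measurable (pairSum h) := by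
  unfold pairSum; fun_prop

/-- A collision invariant is unchanged by the symmetries of the pairs of states that preserve the
outcome of the collision. -/
theorem pairSum_symmetry {h : Vel × ℝ → ℝ} (hm : Measurable h)
    (hinv : ∀ᵐ p ∂totalMeasure P S, defect h p = 0)
    {θ : Vel × Vel → Vel × Vel} {τ : ℝ × ℝ → ℝ × ℝ}
    (hθ : Measure.QuasiMeasurePreserving θ (velPairMeasure P S) (velPairMeasure P S))
    (hτ : Measure.QuasiMeasurePreserving τ ((intMeasure P S).prod (intMeasure P S))
      ((intMeasure P S).prod (intMeasure P S)))
    (hcθ : ∀ v σ, collVel (θ v, σ) = collVel (v, σ))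
    (hcτ : ∀ e r, collInt (τ e, r) = collInt (e, r)) :
    ∀ᵐ x ∂pairMeasure P S, pairSum h (θ x.1, τ x.2) = pairSum h x := by
  have hq : Measure.QuasiMeasurePreserving (Prod.map (Prod.map θ id) (Prod.map τ id))
      (totalMeasure P S) (totalMeasure P S) :=
    QuasiMeasurePreserving.prodMap
      (QuasiMeasurePreserving.prodMap hθ (Measure.QuasiMeasurePreserving.id _))
      (QuasiMeasurePreserving.prodMap hτ (Measure.QuasiMeasurePreserving.id _))
  have m1 := hθ.measurable
  have m2 := hτ.measurable
  refine ae_pairMeasure_of_pre (Q := fun x => pairSum h (θ x.1, τ x.2) = pairSum h x)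
    (measurableSet_eq_fun (by fun_prop) (by fun_prop)) ?_
  filter_upwards [hinv, hq.ae hinv] with p h1 h2
  have e : post (Prod.map (Prod.map θ id) (Prod.map τ id) p) = post p := by
    simp only [post, Prod.map, id, hcθ, hcτ]
  rw [defect, sub_eq_zero] at h1 h2
  rw [e] at h2
  exact h2.trans h1.symm

theorem ae_linear_ne {f : Vel →ₗ[ℝ] ℝ} (hf : f ≠ 0) (k : ℝ) : ∀ᵐ η : Vel, f η ≠ k := by
  obtain ⟨x, hx⟩ : ∃ x, f x ≠ 0 := by
    by_contra! h
    exact hf (LinearMap.ext h)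
  have hnull := Measure.addHaar_affineSubspace (volume : Measure Vel)
    (AffineSubspace.mk' ((k / f x) • x) (LinearMap.ker f)) (by
      intro h
      have := congrArg AffineSubspace.direction h
      rw [AffineSubspace.direction_mk', AffineSubspace.direction_top, LinearMap.ker_eq_top] at this
      exact hf this)
  rw [ae_iff]
  refine measure_mono_null (fun η hη => ?_) hnull
  simp only [ne_eq, not_not, mem_ofPred_eq] at hη
  simp [AffineSubspace.mem_mk', hη, hx]

theorem ae_coord_ne (u : Vel) (i : Fin 3) (k : ℝ) : ∀ᵐ η : Vel, (η - u) i ≠ k := by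
  have hp : (EuclideanSpace.proj i : Vel →L[ℝ] ℝ).toLinearMap ≠ 0 := by
    intro h
    have := LinearMap.congr_fun h (EuclideanSpace.single i (1 : ℝ))
    simp at this
  filter_upwards [ae_linear_ne hp (u i + k)] with η hη h
  refine hη ?_
  simp only [PiLp.sub_apply] at h
  simp
  linarith

/-- Two velocities are in general position almost surely. -/
theorem ae_general_position (u : Vel) :
    ∀ᵐ v ∂((volume : Measure Vel).prod volume), (v.1 - u) 0 ≠ 0 ∧ (v.2 - u) 0 ≠ 0 ∧
      (v.2 - u) 0 ≠ (v.1 - u) 0 ∧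
      (v.1 - u) 1 * (v.2 - u) 2 - (v.1 - u) 2 * (v.2 - u) 1 ≠ 0 := by
  have hc := ae_coord_ne u
  refine (Measure.ae_prod_iff_ae_ae ?_).2 ?_
  · have m : ∀ i : Fin 3, Measurable fun v : Vel × Vel => (v.1 - u) i := fun i => by fun_prop
    have m' : ∀ i : Fin 3, Measurable fun v : Vel × Vel => (v.2 - u) i := fun i => by fun_prop
    refine MeasurableSet.inter ?_ (MeasurableSet.inter ?_ (MeasurableSet.inter ?_ ?_))
    · exact (measurableSet_eq_fun (m 0) measurable_const).compl
    · exact (measurableSet_eq_fun (m' 0) measurable_const).compl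
    · exact (measurableSet_eq_fun (m' 0) (m 0)).compl
    · exact (measurableSet_eq_fun (((m 1).mul (m' 2)).sub ((m 2).mul (m' 1)))
        measurable_const).compl
  · filter_upwards [hc 0 0, hc 1 0] with ξ h0 h1
    -- For fixed `ξ` the determinant is `f η - f u` with `f` linear and nonzero, so it vanishes only
    -- on a hyperplane.
    set f : Vel →ₗ[ℝ] ℝ := (ξ - u) 1 • (EuclideanSpace.proj 2 : Vel →L[ℝ] ℝ).toLinearMap -
      (ξ - u) 2 • (EuclideanSpace.proj 1 : Vel →L[ℝ] ℝ).toLinearMap with hf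
    have hf0 : f ≠ 0 := by
      intro h
      have := LinearMap.congr_fun h (EuclideanSpace.single 2 (1 : ℝ))
      simp only [hf] at this
      simp at this
      simp only [PiLp.sub_apply] at h1
      exact h1 this
    filter_upwards [hc 0 0, hc 0 ((ξ - u) 0), ae_linear_ne hf0 (f u)] with η h2 h3 h4
    refine ⟨h0, h2, h3, fun h => h4 ?_⟩
    rw [← sub_eq_zero, ← map_sub]
    simpa [hf] using h

variable (P S) in
theorem volume_ac_velPairMeasure :
    (volume : Measure Vel).prod (volume : Measure Vel) ≪ velPairMeasure P S := by
  refine withDensity_absolutelyContinuous' (by fun_prop) ?_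
  filter_upwards [ae_general_position S.u] with v hv
  have h1 := expTr_pos P S ‖v.1 - S.u‖
  have h2 := expTr_pos P S ‖v.2 - S.u‖
  have h3 : 0 < ‖v.1 - v.2‖ := by
    refine norm_pos_iff.2 (sub_ne_zero.2 fun h => ?_)
    rw [h] at hv
    exact hv.2.2.1 rfl
  simp only [ne_eq, ENNReal.ofReal_eq_zero, not_le, velPairDensity]
  positivity

variable (P S) in
theorem ac_pairMeasure : ((volume : Measure Vel).prod (volume : Measure Vel)).prod
    ((intMeasure P S).prod (intMeasure P S)) ≪ pairMeasure P S :=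
  (volume_ac_velPairMeasure P S).prod Measure.AbsolutelyContinuous.rfl

/-- If the tensorial function with the coefficient `D` is a collision invariant, then `D` does not
depend on the internal energy. -/
theorem ae_eq_of_tensor_invariant {D : Vel × ℝ → ℝ} (hD : Measurable D)
    (hinv : ∀ i j : Fin 3, ∀ᵐ p ∂totalMeasure P S,
      defect (fun z => Aij i j (z.1 - S.u) * D z) p = 0) :
    ∀ᵐ x ∂((volume : Measure Vel).prod (volume : Measure Vel)).prod
      ((intMeasure P S).prod (intMeasure P S)), D (x.1.1, x.2.1) = D (x.1.1, x.2.2) := by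
  have hA : ∀ i j : Fin 3, Measurable fun z : Vel × ℝ => Aij i j (z.1 - S.u) * D z := by
    intro i j
    unfold Aij
    fun_prop
  have key : ∀ i j : Fin 3, ∀ᵐ x ∂pairMeasure P S,
      pairSum (fun z => Aij i j (z.1 - S.u) * D z) (x.1, x.2.swap) =
        pairSum (fun z => Aij i j (z.1 - S.u) * D z) x := fun i j =>
    pairSum_symmetry (θ := id) (hA i j) (hinv i j) (Measure.QuasiMeasurePreserving.id _)
      Measure.measurePreserving_swap.quasiMeasurePreserving (fun _ _ => rfl)
      (fun e r => by simp only [collInt, Prod.fst_swap, Prod.snd_swap, add_comm e.2])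
  filter_upwards [(ac_pairMeasure P S).ae_le (key 0 1), (ac_pairMeasure P S).ae_le (key 0 2),
    Measure.quasiMeasurePreserving_fst.ae (ae_general_position S.u)] with x h1 h2 h3
  obtain ⟨n1, n2, -, n3⟩ := h3
  simp only [pairSum, fstState, sndState, Prod.fst_swap, Prod.snd_swap, Aij] at h1 h2
  rw [if_neg (by decide), mul_zero, sub_zero, mul_zero, sub_zero] at h1 h2
  simp only [PiLp.sub_apply] at h1 h2
  simp only [PiLp.sub_apply] at n1 n2 n3
  -- Swapping the energies gives `A_ij(c) (D(c,I) - D(c,I_*)) = A_ij(c_*) (D(c_*,I) - D(c_*,I_*))`.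
  -- The components `(0,1)` and `(0,2)` form a linear system in the two differences, with
  -- determinant `± c_0 c_*0 (c_1 c_*2 - c_2 c_*1)`.
  have : (x.1.1 0 - S.u 0) * (x.1.2 0 - S.u 0) *
      ((x.1.1 1 - S.u 1) * (x.1.2 2 - S.u 2) - (x.1.1 2 - S.u 2) * (x.1.2 1 - S.u 1)) *
      (D (x.1.1, x.2.1) - D (x.1.1, x.2.2)) = 0 := by
    linear_combination -(x.1.2 0 - S.u 0) * (x.1.2 2 - S.u 2) * h1 +
      (x.1.2 0 - S.u 0) * (x.1.2 1 - S.u 1) * h2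
  exact sub_eq_zero.1 ((mul_eq_zero.1 this).resolve_left (mul_ne_zero (mul_ne_zero n1 n2) n3))

/-- The exchange of the first components of two velocities. -/
def exchangeFst : Vel × Vel →ₗ[ℝ] Vel × Vel :=
  let d : Vel × Vel →ₗ[ℝ] Vel :=
    LinearMap.toSpanSingleton ℝ Vel (EuclideanSpace.single 0 (1 : ℝ)) ∘ₗ
    (EuclideanSpace.proj 0 : Vel →L[ℝ] ℝ).toLinearMap ∘ₗ
      (LinearMap.snd ℝ Vel Vel - LinearMap.fst ℝ Vel Vel)
  (LinearMap.fst ℝ Vel Vel + d).prod (LinearMap.snd ℝ Vel Vel - d)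

theorem exchangeFst_apply (v : Vel × Vel) : exchangeFst v =
    (v.1 + (v.2 0 - v.1 0) • EuclideanSpace.single 0 (1 : ℝ),
      v.2 - (v.2 0 - v.1 0) • EuclideanSpace.single 0 (1 : ℝ)) := by
  simp [exchangeFst]

theorem exchangeFst_exchangeFst (v : Vel × Vel) : exchangeFst (exchangeFst v) = v := by
  simp only [exchangeFst_apply]
  ext i <;> fin_cases i <;> simp

/-- An involution has determinant of square one. Nonvanishing is enough for null sets to be
preserved. -/
theorem det_exchangeFst_ne_zero : LinearMap.det exchangeFst ≠ 0 := by
  have h : exchangeFst ∘ₗ exchangeFst = LinearMap.id :=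
    LinearMap.ext exchangeFst_exchangeFst
  have h2 := congrArg LinearMap.det h
  rw [LinearMap.det_comp, LinearMap.det_id] at h2
  exact left_ne_zero_of_mul_eq_one h2

/-- The exchange keeps the sum of the velocities and flips the sign of one component of their
difference, so the relative speed is kept too. -/
theorem collVel_exchangeFst (v : Vel × Vel) (σ : Metric.sphere (0 : Vel) 1) :
    collVel (exchangeFst v, σ) = collVel (v, σ) := by
  have h1 : (exchangeFst v).1 + (exchangeFst v).2 = v.1 + v.2 := by
    rw [exchangeFst_apply, add_add_sub_cancel]
  have h2 : ‖(exchangeFst v).1 - (exchangeFst v).2‖ = ‖v.1 - v.2‖ := by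
    rw [EuclideanSpace.norm_eq, EuclideanSpace.norm_eq, exchangeFst_apply]
    simp [Fin.sum_univ_three]
    congr 2
    ring
  simp only [collVel, postVel, h1, h2]

/-- If the vectorial function with the coefficient `D` is a collision invariant, then `D` is
constant. -/
theorem ae_eq_of_vector_invariant {D : Vel × ℝ → ℝ} (hD : Measurable D)
    (hinv : ∀ i : Fin 3, ∀ᵐ p ∂totalMeasure P S, defect (fun z => (z.1 - S.u) i * D z) p = 0) :
    ∀ᵐ x ∂((volume : Measure Vel).prod (intMeasure P S)).prod
      ((volume : Measure Vel).prod (intMeasure P S)), D x.1 = D x.2 := by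
  have hq : Measure.QuasiMeasurePreserving exchangeFst (velPairMeasure P S)
      (velPairMeasure P S) :=
    (Measure.LinearMap.quasiMeasurePreserving ((volume : Measure Vel).prod volume) exchangeFst
      det_exchangeFst_ne_zero).mono (withDensity_absolutelyContinuous _ _)
      (volume_ac_velPairMeasure P S)
  have key : ∀ i : Fin 3, ∀ᵐ x ∂pairMeasure P S,
      pairSum (fun z => (z.1 - S.u) i * D z) (exchangeFst x.1, x.2) =
        pairSum (fun z => (z.1 - S.u) i * D z) x := fun i =>
    pairSum_symmetry (τ := id) (by fun_prop) (hinv i) hq (Measure.QuasiMeasurePreserving.id _)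
      collVel_exchangeFst (fun _ _ => rfl)
  have h : ∀ᵐ x ∂((volume : Measure Vel).prod (volume : Measure Vel)).prod
      ((intMeasure P S).prod (intMeasure P S)), D (x.1.1, x.2.1) = D (x.1.2, x.2.2) := by
    filter_upwards [(ac_pairMeasure P S).ae_le (key 0), (ac_pairMeasure P S).ae_le (key 1),
      (ac_pairMeasure P S).ae_le (key 2),
      Measure.quasiMeasurePreserving_fst.ae (ae_general_position S.u)] with x h0 h1 h2 h3
    obtain ⟨-, -, n1, n2⟩ := h3
    simp only [pairSum, fstState, sndState, PiLp.sub_apply] at h0 h1 h2 n1 n2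
    have c0 : (exchangeFst x.1).1 0 = x.1.2 0 := by simp [exchangeFst_apply]
    have c0' : (exchangeFst x.1).2 0 = x.1.1 0 := by simp [exchangeFst_apply]
    have c1 : (exchangeFst x.1).1 1 = x.1.1 1 := by simp [exchangeFst_apply]
    have c1' : (exchangeFst x.1).2 1 = x.1.2 1 := by simp [exchangeFst_apply]
    have c2 : (exchangeFst x.1).1 2 = x.1.1 2 := by simp [exchangeFst_apply]
    have c2' : (exchangeFst x.1).2 2 = x.1.2 2 := by simp [exchangeFst_apply]
    rw [c0, c0'] at h0
    rw [c1, c1'] at h1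
    rw [c2, c2'] at h2
    -- The components `1` and `2` of the velocities are unchanged, so these two equations determine
    -- the values `a`, `b` after the exchange: they equal the values before it. Component `0`, which
    -- is exchanged, then compares the two molecules with each other.
    set a := D ((exchangeFst x.1).1, x.2.1)
    set b := D ((exchangeFst x.1).2, x.2.2)
    have e1 : ((x.1.1 1 - S.u 1) * (x.1.2 2 - S.u 2) - (x.1.1 2 - S.u 2) * (x.1.2 1 - S.u 1)) *
        (a - D (x.1.1, x.2.1)) = 0 := by
      linear_combination (x.1.2 2 - S.u 2) * h1 - (x.1.2 1 - S.u 1) * h2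
    have e2 : ((x.1.1 1 - S.u 1) * (x.1.2 2 - S.u 2) - (x.1.1 2 - S.u 2) * (x.1.2 1 - S.u 1)) *
        (b - D (x.1.2, x.2.2)) = 0 := by
      linear_combination (x.1.1 1 - S.u 1) * h2 - (x.1.1 2 - S.u 2) * h1
    have e1' := sub_eq_zero.1 ((mul_eq_zero.1 e1).resolve_left n2)
    have e2' := sub_eq_zero.1 ((mul_eq_zero.1 e2).resolve_left n2)
    rw [e1', e2'] at h0
    have e3 : (x.1.2 0 - S.u 0 - (x.1.1 0 - S.u 0)) * (D (x.1.1, x.2.1) - D (x.1.2, x.2.2)) = 0 := by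
      linear_combination h0
    exact sub_eq_zero.1 ((mul_eq_zero.1 e3).resolve_left (sub_ne_zero.2 n1))
  exact (measurePreserving_interchange (volume : Measure Vel) (intMeasure P S) volume
    (intMeasure P S)).quasiMeasurePreserving.ae h

end Invariants

/-! ### From phase space to the quadrant of speeds and internal energies. -/

section RadialTransfer

variable {P : Model} {S : FluidState}

section Radial

/-- The modulus of the peculiar velocity and the internal energy of a state. -/
def radial (u : Vel) (z : Vel × ℝ) : ℝ × ℝ := (‖z.1 - u‖, z.2)

@[fun_prop]
theorem measurable_radial (u : Vel) : Measurable (radial u) := by unfold radial; fun_prop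

theorem map_norm_sub (u : Vel) : (volume : Measure Vel).map (fun ξ => ‖ξ - u‖) =
    sphereMeasure univ •
      (volume.restrict (Ioi (0 : ℝ))).withDensity fun r => ENNReal.ofReal (r ^ 2) := by
  refine Measure.ext_of_lintegral _ fun f hf => ?_
  rw [lintegral_map hf (by fun_prop), lintegral_sub_right_eq_self (fun ξ : Vel => f ‖ξ‖) u,
    lintegral_eq_lintegral_toSphere (by fun_prop), lintegral_smul_measure,
    lintegral_withDensity_eq_lintegral_mul _ (by fun_prop) hf]
  have h : ∀ σ : Metric.sphere (0 : Vel) 1,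
      ∫⁻ r in Ioi (0 : ℝ), ENNReal.ofReal (r ^ 2) * f ‖r • (σ : Vel)‖ =
        ∫⁻ r in Ioi (0 : ℝ), ENNReal.ofReal (r ^ 2) * f r := by
    intro σ
    refine setLIntegral_congr_fun measurableSet_Ioi fun r hr => ?_
    have : ‖r • (σ : Vel)‖ = r := by
      rw [norm_smul, norm_eq_of_mem_sphere, mul_one, Real.norm_of_nonneg (le_of_lt hr)]
    simp only [this]
  simp only [h, lintegral_const, smul_eq_mul, Pi.mul_apply]
  rw [mul_comm]

theorem map_radial (u : Vel) : phaseMeasure.map (radial u) =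
    sphereMeasure univ • quadrantMeasure.withDensity fun z => ENNReal.ofReal (z.1 ^ 2) := by
  have h : radial u = Prod.map (fun ξ => ‖ξ - u‖) id := rfl
  rw [h, phaseMeasure, ← Measure.map_prod_map _ _ (by fun_prop) measurable_id, Measure.map_id,
    map_norm_sub, Measure.prod_smul_left, prod_withDensity_left (by fun_prop)]
  rfl

theorem sphereMeasure_univ_ne_zero : sphereMeasure univ ≠ 0 := by
  rw [Ne, Measure.measure_univ_eq_zero]
  exact Measure.toSphere_ne_zero _

theorem ae_quadrant_pos : ∀ᵐ z ∂quadrantMeasure, 0 < z.1 ∧ 0 < z.2 := by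
  unfold quadrantMeasure
  filter_upwards [Measure.quasiMeasurePreserving_fst.ae
      (ae_restrict_mem (μ := volume) (measurableSet_Ioi (a := (0 : ℝ)))),
    Measure.quasiMeasurePreserving_snd.ae
      (ae_restrict_mem (μ := volume) (measurableSet_Ioi (a := (0 : ℝ))))] with z h1 h2
  exact ⟨h1, h2⟩

instance : SFinite quadrantMeasure := by unfold quadrantMeasure; infer_instance

/-- The image of phase space is the quadrant with density `c²` up to a nonzero constant, and this
density is positive almost everywhere. -/
theorem ae_quadrant_of_radial {Q : ℝ × ℝ → Prop} (hQ : MeasurableSet {z | Q z}) (u : Vel)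
    (h : ∀ᵐ z ∂phaseMeasure, Q (radial u z)) : ∀ᵐ z ∂quadrantMeasure, Q z := by
  have h1 : ∀ᵐ z ∂phaseMeasure.map (radial u), Q z :=
    (ae_map_iff (measurable_radial u).aemeasurable hQ).2 h
  rw [map_radial] at h1
  have h2 := (Measure.absolutelyContinuous_smul sphereMeasure_univ_ne_zero).ae_le h1
  refine (withDensity_absolutelyContinuous' (by fun_prop) ?_).ae_le h2
  filter_upwards [ae_quadrant_pos] with z hz
  simpa using hz.1.ne'

theorem integrable_radial {f : ℝ × ℝ → ℝ} (hf : Measurable f) (u : Vel)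
    (h : Integrable (fun z => f (radial u z)) phaseMeasure) :
    Integrable (fun z => z.1 ^ 2 * f z) quadrantMeasure := by
  have h1 : Integrable f (phaseMeasure.map (radial u)) :=
    (integrable_map_measure hf.aestronglyMeasurable (by fun_prop)).2 h
  rw [map_radial, integrable_smul_measure sphereMeasure_univ_ne_zero (measure_ne_top _ _),
    integrable_withDensity_iff_integrable_smul' (by fun_prop) (by simp)] at h1
  refine h1.congr (Filter.Eventually.of_forall fun z => ?_)
  simp only [smul_eq_mul]
  rw [ENNReal.toReal_ofReal (sq_nonneg _)]

theorem integral_radial {f : ℝ × ℝ → ℝ} (hf : Measurable f) (u : Vel) :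
    ∫ z, f (radial u z) ∂phaseMeasure =
      sphereMeasure.real univ * ∫ z, z.1 ^ 2 * f z ∂quadrantMeasure := by
  rw [← integral_map (by fun_prop) hf.aestronglyMeasurable, map_radial, integral_smul_measure,
    integral_withDensity_eq_integral_toReal_smul (by fun_prop) (by simp), smul_eq_mul]
  congr 1
  refine integral_congr_ae (Filter.Eventually.of_forall fun z => ?_)
  simp only [smul_eq_mul]
  rw [ENNReal.toReal_ofReal (sq_nonneg _)]

variable (P S) in
theorem velMeasure_prod_intMeasure : (velMeasure P S).prod (intMeasure P S) =
    phaseMeasure.withDensity fun z =>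
      ENNReal.ofReal (expTr P S ‖z.1 - S.u‖) * ENNReal.ofReal (intWeight P S z.2) := by
  rw [velMeasure, intMeasure, prod_withDensity (by fun_prop) (by fun_prop), phaseMeasure]

theorem ae_phase_pos : ∀ᵐ z ∂phaseMeasure, 0 < z.2 :=
  Measure.quasiMeasurePreserving_snd.ae (ae_restrict_mem measurableSet_Ioi)

theorem toReal_phaseDensity {z : Vel × ℝ} (hz : 0 < z.2) :
    (ENNReal.ofReal (expTr P S ‖z.1 - S.u‖) * ENNReal.ofReal (intWeight P S z.2)).toReal =
      expTr P S ‖z.1 - S.u‖ * intWeight P S z.2 := by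
  rw [ENNReal.toReal_mul, ENNReal.toReal_ofReal (expTr_pos P S _).le,
    ENNReal.toReal_ofReal (intWeight_pos P S hz).le]

theorem integrable_quadrant {f : ℝ × ℝ → ℝ} (hf : Measurable f)
    (h : Integrable (fun z => f (radial S.u z)) ((velMeasure P S).prod (intMeasure P S))) :
    Integrable (fun z => z.1 ^ 2 * (expTr P S z.1 * intWeight P S z.2 * f z)) quadrantMeasure := by
  rw [velMeasure_prod_intMeasure, integrable_withDensity_iff_integrable_smul' (by fun_prop)
    (Filter.Eventually.of_forall fun z => by finiteness)] at h
  refine integrable_radial (f := fun z => expTr P S z.1 * intWeight P S z.2 * f z)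
    (by fun_prop) S.u (h.congr ?_)
  filter_upwards [ae_phase_pos] with z hz
  rw [toReal_phaseDensity hz, smul_eq_mul, radial]

theorem integral_quadrant {f : ℝ × ℝ → ℝ} (hf : Measurable f) :
    ∫ z, f (radial S.u z) ∂(velMeasure P S).prod (intMeasure P S) = sphereMeasure.real univ *
      ∫ z, z.1 ^ 2 * (expTr P S z.1 * intWeight P S z.2 * f z) ∂quadrantMeasure := by
  rw [velMeasure_prod_intMeasure, integral_withDensity_eq_integral_toReal_smul (by fun_prop)
    (Filter.Eventually.of_forall fun z => by finiteness),
    ← integral_radial (f := fun z => expTr P S z.1 * intWeight P S z.2 * f z) (by fun_prop) S.u]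
  refine integral_congr_ae ?_
  filter_upwards [ae_phase_pos] with z hz
  rw [toReal_phaseDensity hz, smul_eq_mul, radial]

end Radial

section Moments

variable (P S) in
theorem velMeasure_prod_le : (velMeasure P S).prod (intMeasure P S) ≤ domMeasure P S :=
  Measure.prod_mono (velMeasure_le_velDomMeasure P S) le_rfl

/-- The square integrable functions of velocity and internal energy that occur in the moments. -/
theorem memLp_norm_pow_mul_pow (k j : ℕ) :
    MemLp (fun z : Vel × ℝ => ‖z.1 - S.u‖ ^ k * z.2 ^ j) 2
      ((velMeasure P S).prod (intMeasure P S)) := by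
  refine (memLp_two_iff_integrable_sq (by fun_prop)).2 ?_
  refine ((integrable_norm_pow_velMeasure P S (2 * k)).mul_prod
    (integrable_pow_intMeasure P S (2 * j))).congr (Filter.Eventually.of_forall fun z => ?_)
  simp only
  ring

theorem memLp_norm_mul_of_vector {D : Vel × ℝ → ℝ} (hD : Measurable D)
    (h : ∀ i : Fin 3, MemLp (fun z : Vel × ℝ => (z.1 - S.u) i * D z) 2 (domMeasure P S)) :
    MemLp (fun z : Vel × ℝ => ‖z.1 - S.u‖ * D z) 2 ((velMeasure P S).prod (intMeasure P S)) := by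
  refine MemLp.mono_measure (velMeasure_prod_le P S) ?_
  refine (memLp_two_iff_integrable_sq (by fun_prop)).2 ?_
  have hs := integrable_finsetSum Finset.univ fun i _ => (h i).integrable_sq
  refine hs.congr (Filter.Eventually.of_forall fun z => ?_)
  simp only [mul_pow, EuclideanSpace.norm_sq_eq, Real.norm_eq_abs, sq_abs, Finset.sum_mul]

theorem memLp_norm_sq_mul_of_tensor {D : Vel × ℝ → ℝ} (hD : Measurable D)
    (h : ∀ i j : Fin 3, MemLp (fun z : Vel × ℝ => Aij i j (z.1 - S.u) * D z) 2
      (domMeasure P S)) :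
    MemLp (fun z : Vel × ℝ => ‖z.1 - S.u‖ ^ 2 * D z) 2
      ((velMeasure P S).prod (intMeasure P S)) := by
  refine MemLp.mono_measure (velMeasure_prod_le P S) ?_
  refine (memLp_two_iff_integrable_sq (by fun_prop)).2 ?_
  -- The factor comes from `∑ A_ij(c)² = (2/3) |c|⁴`.
  have hs := (integrable_finsetSum Finset.univ fun i _ =>
    integrable_finsetSum Finset.univ fun j _ => (h i j).integrable_sq).const_mul (3 / 2)
  refine hs.congr (Filter.Eventually.of_forall fun z => ?_)
  have hn : ‖z.1 - S.u‖ ^ 2 = (z.1 - S.u) 0 ^ 2 + (z.1 - S.u) 1 ^ 2 + (z.1 - S.u) 2 ^ 2 := by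
    simp only [EuclideanSpace.norm_sq_eq, Real.norm_eq_abs, sq_abs, Fin.sum_univ_three]
  simp only [Fin.sum_univ_three, Aij, hn]
  simp [Fin.ext_iff]
  ring

end Moments

end RadialTransfer

/-! ### Gamma integrals, and separation of the Chapman–Enskog coefficients. -/

section Reduction

variable {P : Model} {S : FluidState}

section InternalEnergy

variable (P S) in
theorem kT_pos : 0 < P.kB * S.Tint := mul_pos P.kB_pos S.Tint_pos

variable (P S) in
theorem integral_rpow_mul_expInt {s : ℝ} (hs : 0 < s) :
    ∫ I in Ioi (0 : ℝ), I ^ (s - 1) * expInt P S I =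
      (P.kB * S.Tint) ^ s * Real.Gamma s := by
  have h := Real.integral_rpow_mul_exp_neg_mul_Ioi hs (inv_pos.2 (kT_pos P S))
  rw [one_div, inv_inv] at h
  rw [← h]
  simp only [expInt, div_eq_inv_mul]

variable (P S) in
/-- The mass of the distribution of the internal energy. -/
def intMass : ℝ := (P.kB * S.Tint) ^ (P.δ / 2) * Real.Gamma (P.δ / 2)

variable (P S) in
theorem intMass_pos : 0 < intMass P S :=
  mul_pos (Real.rpow_pos_of_pos (kT_pos P S) _) (Real.Gamma_pos_of_pos (half_δ_pos P))

variable (P S) in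
theorem integral_zeroth : ∫ I in Ioi (0 : ℝ), I ^ (P.δ / 2 - 1) * expInt P S I = intMass P S :=
  integral_rpow_mul_expInt P S (half_δ_pos P)

variable (P S) in
theorem integral_first : ∫ I in Ioi (0 : ℝ), I ^ (P.δ / 2) * expInt P S I =
    P.kB * S.Tint * (P.δ / 2) * intMass P S := by
  have hd := half_δ_pos P
  have h := integral_rpow_mul_expInt P S (s := P.δ / 2 + 1) (by linarith)
  rw [add_sub_cancel_right, Real.Gamma_add_one hd.ne', Real.rpow_add_one (kT_pos P S).ne'] at h
  rw [h, intMass]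
  ring

variable (P S) in
theorem integral_second : ∫ I in Ioi (0 : ℝ), I ^ (P.δ / 2 + 1) * expInt P S I =
    (P.kB * S.Tint) ^ 2 * (P.δ / 2 + 1) * (P.δ / 2) * intMass P S := by
  have hd := half_δ_pos P
  have h := integral_rpow_mul_expInt P S (s := P.δ / 2 + 1 + 1) (by linarith)
  rw [add_sub_cancel_right, Real.Gamma_add_one (by linarith), Real.Gamma_add_one hd.ne',
    Real.rpow_add_one (kT_pos P S).ne', Real.rpow_add_one (kT_pos P S).ne'] at h
  rw [h, intMass]
  ring

variable (P S) in
theorem integrable_first : IntegrableOn (fun I => I ^ (P.δ / 2) * expInt P S I) (Ioi 0) :=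
  integrableOn_rpow_mul_expInt P S (by linarith [half_δ_pos P])

variable (P S) in
theorem integrable_second : IntegrableOn (fun I => I ^ (P.δ / 2 + 1) * expInt P S I) (Ioi 0) :=
  integrableOn_rpow_mul_expInt P S (by linarith [half_δ_pos P])

variable (P S) in
theorem integrable_zeroth : IntegrableOn (fun I => I ^ (P.δ / 2 - 1) * expInt P S I) (Ioi 0) :=
  integrableOn_rpow_mul_expInt P S (by linarith [half_δ_pos P])

variable (P S) in
-- By `Γ(s + 1) = s Γ(s)`, the variable `I/(kB T_int)` has mean `δ/2`. This centring makes the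
-- profile of `𝒞` admissible for the projection, and it makes `Λ_int^tr` vanish.
theorem integral_affine_zeroth :
    ∫ I in Ioi (0 : ℝ), (I / (P.kB * S.Tint) - P.δ / 2) * I ^ (P.δ / 2 - 1) * expInt P S I = 0 := by
  have hk := kT_pos P S
  have e : ∫ I in Ioi (0 : ℝ), (I / (P.kB * S.Tint) - P.δ / 2) * I ^ (P.δ / 2 - 1) * expInt P S I =
      ∫ I in Ioi (0 : ℝ), ((P.kB * S.Tint)⁻¹ * (I ^ (P.δ / 2) * expInt P S I) -
        (P.δ / 2) * (I ^ (P.δ / 2 - 1) * expInt P S I)) := by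
    refine setIntegral_congr_fun measurableSet_Ioi fun I hI => ?_
    have : I ^ (P.δ / 2) = I ^ (P.δ / 2 - 1) * I := by
      rw [← Real.rpow_add_one (ne_of_gt hI), sub_add_cancel]
    simp only [this]
    ring
  rw [e, integral_sub ((integrable_first P S).const_mul _) ((integrable_zeroth P S).const_mul _),
    integral_const_mul, integral_const_mul, integral_first, integral_zeroth]
  have := inv_mul_cancel₀ hk.ne'
  linear_combination (P.δ / 2 * intMass P S) * this

variable (P S) in
-- The variance of `I/(kB T_int)` under the Gamma law is also `δ/2`; this is the source of the
-- factor `δ` in `Λ_int^int`.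
theorem integral_affine_first :
    ∫ I in Ioi (0 : ℝ), (I / (P.kB * S.Tint) - P.δ / 2) * I ^ (P.δ / 2) * expInt P S I =
      P.kB * S.Tint * (P.δ / 2) * intMass P S := by
  have hk := kT_pos P S
  have e : ∫ I in Ioi (0 : ℝ), (I / (P.kB * S.Tint) - P.δ / 2) * I ^ (P.δ / 2) * expInt P S I =
      ∫ I in Ioi (0 : ℝ), ((P.kB * S.Tint)⁻¹ * (I ^ (P.δ / 2 + 1) * expInt P S I) -
        (P.δ / 2) * (I ^ (P.δ / 2) * expInt P S I)) := by
    refine setIntegral_congr_fun measurableSet_Ioi fun I hI => ?_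
    simp only [Real.rpow_add_one (ne_of_gt hI)]
    ring
  rw [e, integral_sub ((integrable_second P S).const_mul _) ((integrable_first P S).const_mul _),
    integral_const_mul, integral_const_mul, integral_first, integral_second]
  field_simp
  ring

variable (P S) in
theorem intMeasure_real_univ : (intMeasure P S).real univ = intMass P S := by
  have h := integral_intMeasure P S fun _ => 1
  simp only [integral_const, smul_eq_mul, mul_one, intWeight] at h
  rw [h, integral_zeroth]

variable (P S) in
theorem integral_affine_intMeasure :
    ∫ I, ((P.kB * S.Tint)⁻¹ * I + -(P.δ / 2)) ∂intMeasure P S = 0 := by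
  rw [integral_intMeasure]
  refine Eq.trans ?_ (integral_affine_zeroth P S)
  refine integral_congr_ae (Filter.Eventually.of_forall fun I => ?_)
  simp only [intWeight]
  ring

variable (P S) in
theorem volume_ac_intMeasure : volume.restrict (Ioi (0 : ℝ)) ≪ intMeasure P S := by
  refine withDensity_absolutelyContinuous' (by fun_prop) ?_
  filter_upwards [ae_restrict_mem measurableSet_Ioi] with I hI
  simpa using intWeight_pos P S hI

/-- A nonzero affine function has at most one zero, a null set for the Gamma law. -/
theorem integral_affine_sq_pos {a b : ℝ} (hab : a ≠ 0 ∨ b ≠ 0) :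
    0 < ∫ I, (a * I + b) ^ 2 ∂intMeasure P S := by
  have hmem : MemLp (fun I : ℝ => a * I + b) 2 (intMeasure P S) :=
    ((memLp_id_intMeasure P S).const_mul a).add (memLp_const b)
  refine lt_of_le_of_ne (integral_nonneg fun I => sq_nonneg _) fun h => ?_
  have h1 := (integral_eq_zero_iff_of_nonneg (fun I => sq_nonneg _) hmem.integrable_sq).1 h.symm
  have h2 := (volume_ac_intMeasure P S).ae_le h1
  have h3 : ∀ᵐ I ∂volume.restrict (Ioi (0 : ℝ)), I ≠ -b / a := by
    refine ae_restrict_of_ae ?_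
    exact compl_mem_ae_iff.2 (measure_singleton _)
  have h4 : ∀ᵐ I ∂volume.restrict (Ioi (0 : ℝ)), False := by
    filter_upwards [h2, h3] with I hI hI'
    have h5 : a * I + b = 0 := pow_eq_zero_iff two_ne_zero |>.1 hI
    by_cases ha : a = 0
    · rw [ha, zero_mul, zero_add] at h5
      exact hab.elim (fun k => k ha) fun k => k h5
    · exact hI' (by field_simp; linarith)
  rw [Filter.eventually_false_iff_eq_bot, ae_eq_bot, Measure.restrict_eq_zero] at h4
  simp at h4

end InternalEnergy

section Separation

theorem ae_coord_ne_zero (u : Vel) (i : Fin 3) : ∀ᵐ ξ : Vel, (ξ - u) i ≠ 0 := ae_coord_ne u i 0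

variable (P S) in
theorem volume_ac_velMeasure : (volume : Measure Vel) ≪ velMeasure P S := by
  refine withDensity_absolutelyContinuous' (by fun_prop) (Filter.Eventually.of_forall fun ξ => ?_)
  simpa using expTr_pos P S ‖ξ - S.u‖

variable (P S) in
/-- The radial factor of the projection of `φ` to the multiples of an affine profile. -/
def radialCoef (a b : ℝ) (φ : ℝ → ℝ → ℝ) (c : ℝ) : ℝ :=
  (∫ I, (a * I + b) ^ 2 ∂intMeasure P S)⁻¹ * ∫ I, φ c I * (a * I + b) ∂intMeasure P S

theorem measurable_radialCoef {a b : ℝ} {φ : ℝ → ℝ → ℝ} (hφ : Measurable (Function.uncurry φ)) :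
    Measurable (radialCoef P S a b φ) := by
  have : StronglyMeasurable fun c => ∫ I, φ c I * (a * I + b) ∂intMeasure P S :=
    StronglyMeasurable.integral_prod_right' (f := fun z : ℝ × ℝ => φ z.1 z.2 * (a * z.2 + b))
      (Measurable.stronglyMeasurable (hφ.mul (by fun_prop)))
  exact this.measurable.const_mul _

variable (P S) in
/-- The part of `φ` orthogonal to the affine profile. -/
def radialResidual (a b : ℝ) (φ : ℝ → ℝ → ℝ) (z : Vel × ℝ) : ℝ :=
  φ ‖z.1 - S.u‖ z.2 - (a * z.2 + b) * radialCoef P S a b φ ‖z.1 - S.u‖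

theorem measurable_radialResidual {a b : ℝ} {φ : ℝ → ℝ → ℝ}
    (hφ : Measurable (Function.uncurry φ)) : Measurable (radialResidual P S a b φ) := by
  have h1 : Measurable fun z : Vel × ℝ => φ ‖z.1 - S.u‖ z.2 :=
    hφ.comp (measurable_radial S.u)
  have h2 : Measurable fun z : Vel × ℝ => radialCoef P S a b φ ‖z.1 - S.u‖ :=
    (measurable_radialCoef hφ).comp (by fun_prop)
  unfold radialResidual
  fun_prop

/-- The projection acts on `I` only and commutes with factors of the velocity, so the residual keeps
its tensorial or vectorial form, with one and the same radial coefficient for all components. -/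
theorem residual_eq (a b : ℝ) (φ : ℝ → ℝ → ℝ) (Y : Vel → ℝ) :
    residual P S (fun I => a * I + b) (fun ξ I => Y ξ * φ ‖ξ - S.u‖ I) =
      fun z => Y z.1 * radialResidual P S a b φ z := by
  funext z
  simp only [residual, profileCoef, radialResidual, radialCoef, mul_assoc, integral_const_mul]
  ring

theorem ae_separated_of_residual {a b : ℝ} {φ : ℝ → ℝ → ℝ} (hφ : Measurable (Function.uncurry φ))
    (h : ∀ᵐ z ∂(volume : Measure Vel).prod (intMeasure P S), radialResidual P S a b φ z = 0) :
    ∀ᵐ z ∂quadrantMeasure, φ z.1 z.2 = (a * z.2 + b) * radialCoef P S a b φ z.1 := by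
  have hm := measurable_radialCoef (P := P) (S := S) (a := a) (b := b) hφ
  refine ae_quadrant_of_radial (u := S.u) (measurableSet_eq_fun hφ (by fun_prop)) ?_
  have hac : phaseMeasure ≪ (volume : Measure Vel).prod (intMeasure P S) :=
    Measure.AbsolutelyContinuous.prod Measure.AbsolutelyContinuous.rfl (volume_ac_intMeasure P S)
  filter_upwards [hac.ae_le h] with z hz
  exact sub_eq_zero.1 hz

theorem integral_radialResidual_mul {a b : ℝ} {φ : ℝ → ℝ → ℝ} {Y : Vel → ℝ} (hY : Measurable Y)
    (hφ : Measurable (Function.uncurry φ)) (hab : a ≠ 0 ∨ b ≠ 0)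
    (hY0 : ∀ᵐ ξ : Vel, Y ξ ≠ 0)
    (hh : MemLp (Function.uncurry fun ξ I => Y ξ * φ ‖ξ - S.u‖ I) 2 (domMeasure P S)) :
    ∀ᵐ ξ : Vel, ∫ I, radialResidual P S a b φ (ξ, I) * (a * I + b) ∂intMeasure P S = 0 := by
  have hm : Measurable (Function.uncurry fun ξ I => Y ξ * φ ‖ξ - S.u‖ I) :=
    (hY.comp measurable_fst).mul (hφ.comp (measurable_radial S.u))
  have h := integral_residual_mul (χ := fun I => a * I + b)
    (((memLp_id_intMeasure P S).const_mul a).add (memLp_const b))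
    (integral_affine_sq_pos hab) hm hh
  filter_upwards [(volume_ac_velDomMeasure P S).ae_le h, hY0] with ξ h1 h2
  rw [residual_eq] at h1
  simp only [mul_assoc, integral_const_mul] at h1
  exact (mul_eq_zero.1 h1).resolve_left h2

theorem ae_separated_tensor (hα : P.α = 0) {φ : ℝ → ℝ → ℝ}
    (hφ : Measurable (Function.uncurry φ))
    (hsol : ∀ i j : Fin 3, Solves P S (fun ξ I => Aij i j (ξ - S.u) * φ ‖ξ - S.u‖ I)
      (fun ξ _ => Aij i j (ξ - S.u))) :
    ∀ᵐ z ∂quadrantMeasure, φ z.1 z.2 = (0 * z.2 + 1) * radialCoef P S 0 1 φ z.1 := by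
  refine ae_separated_of_residual (P := P) (S := S) hφ ?_
  have hAm : ∀ i j : Fin 3, Measurable fun ξ : Vel => Aij i j (ξ - S.u) := fun i j => by
    unfold Aij; fun_prop
  have hD := measurable_radialResidual (P := P) (S := S) (a := 0) (b := 1) hφ
  have hinv : ∀ i j : Fin 3, ∀ᵐ p ∂totalMeasure P S,
      defect (fun z => Aij i j (z.1 - S.u) * radialResidual P S 0 1 φ z) p = 0 := by
    intro i j
    have h := defect_residual_ae_eq_zero (a := 0) (b := 1)
      (h := fun ξ I => Aij i j (ξ - S.u) * φ ‖ξ - S.u‖ I) hα (Or.inl rfl)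
      (integral_affine_sq_pos (Or.inr one_ne_zero))
      (((hAm i j).comp measurable_fst).mul (hφ.comp (measurable_radial S.u))) (hsol i j).1
      (y := fun ξ => Aij i j (ξ - S.u)) (by
        filter_upwards [(hsol i j).2] with z hz
        rw [hz]; ring)
    rwa [residual_eq 0 1 φ fun ξ => Aij i j (ξ - S.u)] at h
  have hconst := ae_eq_of_tensor_invariant hD hinv
  have hgen : ∀ᵐ ξ : Vel, Aij 0 1 (ξ - S.u) ≠ 0 := by
    filter_upwards [ae_coord_ne_zero S.u 0, ae_coord_ne_zero S.u 1] with ξ h0 h1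
    simp [Aij] at h0 h1 ⊢
    exact ⟨h0, h1⟩
  have hzero := integral_radialResidual_mul (a := 0) (b := 1) (hAm 0 1) hφ
    (Or.inr one_ne_zero) hgen ((hsol 0 1).1.memLp_domMeasure hα)
  have h1 := Measure.ae_ae_of_ae_prod hconst
  have h2 : ∀ᵐ ξ : Vel, ∀ᵐ e ∂(intMeasure P S).prod (intMeasure P S),
      radialResidual P S 0 1 φ (ξ, e.1) = radialResidual P S 0 1 φ (ξ, e.2) := by
    have h3 := Measure.ae_ae_of_ae_prod h1
    filter_upwards [h3] with ξ hξ
    -- The conclusion does not involve the second velocity, so a single admissible value of it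
    -- suffices.
    exact hξ.exists.choose_spec
  refine (Measure.ae_prod_iff_ae_ae (measurableSet_eq_fun hD measurable_const)).2 ?_
  filter_upwards [h2, hzero] with ξ h3 h4
  filter_upwards [Measure.ae_ae_of_ae_prod h3] with I hI
  -- For this `ξ` the residual is constant in the internal energy and orthogonal to the constants,
  -- hence zero.
  have h5 : ∫ J, radialResidual P S 0 1 φ (ξ, J) * (0 * J + 1) ∂intMeasure P S =
      ∫ _J, radialResidual P S 0 1 φ (ξ, I) ∂intMeasure P S := by
    refine integral_congr_ae ?_
    filter_upwards [hI] with J hJ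
    rw [← hJ]; ring
  rw [h4, integral_const, smul_eq_mul, intMeasure_real_univ] at h5
  exact (mul_eq_zero.1 h5.symm).resolve_left (intMass_pos P S).ne'

/-- The invariants `c_i D` with `D` constant are the momenta, so `L_r` alone leaves a constant `D`
undetermined. It is removed by showing that its moment with weight `|c|²` vanishes. -/
theorem ae_separated_vector (hα : P.α = 0) {φ : ℝ → ℝ → ℝ} {a b : ℝ} (hab : a ≠ 0 ∨ b ≠ 0)
    (hcase : a = 0 ∨ ∫ I, (a * I + b) ∂intMeasure P S = 0)
    (hφ : Measurable (Function.uncurry φ)) {y : Fin 3 → Vel → ℝ}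
    (hsol : ∀ i : Fin 3, Solves P S (fun ξ I => (ξ - S.u) i * φ ‖ξ - S.u‖ I)
      (fun ξ I => y i ξ * (a * I + b)))
    (hc : Constraint P S φ) :
    ∀ᵐ z ∂quadrantMeasure, φ z.1 z.2 = (a * z.2 + b) * radialCoef P S a b φ z.1 := by
  refine ae_separated_of_residual (P := P) (S := S) hφ ?_
  set D := radialResidual P S a b φ with hDdef
  have hD : Measurable D := measurable_radialResidual hφ
  have hκ := integral_affine_sq_pos (P := P) (S := S) hab
  have hχ : MemLp (fun I : ℝ => a * I + b) 2 (intMeasure P S) :=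
    ((memLp_id_intMeasure P S).const_mul a).add (memLp_const b)
  have hYm : ∀ i : Fin 3, Measurable fun ξ : Vel => (ξ - S.u) i := fun i => by fun_prop
  have hhm : ∀ i : Fin 3, Measurable (Function.uncurry fun (ξ : Vel) I =>
      (ξ - S.u) i * φ ‖ξ - S.u‖ I) := fun i =>
    ((hYm i).comp measurable_fst).mul (hφ.comp (measurable_radial S.u))
  have hdom := fun i => (hsol i).1.memLp_domMeasure hα
  have hinv : ∀ i : Fin 3, ∀ᵐ p ∂totalMeasure P S,
      defect (fun z => (z.1 - S.u) i * D z) p = 0 := by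
    intro i
    have h := defect_residual_ae_eq_zero hα hcase hκ (hhm i) (hsol i).1 (y := y i) (hsol i).2
    rwa [residual_eq a b φ fun ξ => (ξ - S.u) i] at h
  have hconst := ae_eq_of_vector_invariant hD hinv
  have hDdom : ∀ i : Fin 3, MemLp (fun z : Vel × ℝ => (z.1 - S.u) i * D z) 2
      (domMeasure P S) := by
    intro i
    have h := memLp_residual (by fun_prop) hχ hκ (hhm i) (hdom i)
    rwa [residual_eq a b φ fun ξ => (ξ - S.u) i] at h
  have hint : ∀ {F : Vel × ℝ → ℝ}, Measurable F → (∀ i : Fin 3, MemLp (fun z : Vel × ℝ =>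
      (z.1 - S.u) i * F z) 2 (domMeasure P S)) → Integrable (fun z : Vel × ℝ =>
      ‖z.1 - S.u‖ ^ 2 * F z) ((velMeasure P S).prod (intMeasure P S)) := by
    intro F hF hFdom
    have h := (memLp_norm_pow_mul_pow (P := P) (S := S) 1 0).integrable_mul
      (memLp_norm_mul_of_vector hF hFdom)
    refine h.congr (Filter.Eventually.of_forall fun z => ?_)
    simp only [Pi.mul_apply]
    ring
  have hDint := hint hD hDdom
  have hmean : ∫ z, ‖z.1 - S.u‖ ^ 2 * D z ∂(velMeasure P S).prod (intMeasure P S) = 0 := by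
    -- For a constant profile the residual has mean zero in `I` already. For a centred profile the
    -- constraint kills the moment of `φ`, and the moment of the projected part contains the factor
    -- `∫ χ = 0`.
    rcases hcase with rfl | h0
    · have hb : b ≠ 0 := hab.resolve_left fun h => h rfl
      rw [integral_prod _ hDint]
      refine integral_eq_zero_of_ae ?_
      have hac : velMeasure P S ≪ volume := withDensity_absolutelyContinuous _ _
      filter_upwards [hac.ae_le (integral_radialResidual_mul (hYm 0) hφ hab
        (ae_coord_ne_zero S.u 0) (hdom 0))] with ξ hξ
      simp only [zero_mul, zero_add, integral_mul_const] at hξ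
      simp only [integral_const_mul, Pi.zero_apply]
      rw [(mul_eq_zero.1 hξ).resolve_right hb, mul_zero]
    · have i1 : Integrable (fun z : Vel × ℝ => ‖z.1 - S.u‖ ^ 2 * φ ‖z.1 - S.u‖ z.2)
          ((velMeasure P S).prod (intMeasure P S)) :=
        hint (hφ.comp (measurable_radial S.u)) hdom
      have e1 : ∫ z, ‖z.1 - S.u‖ ^ 2 * φ ‖z.1 - S.u‖ z.2
          ∂(velMeasure P S).prod (intMeasure P S) = 0 := by
        have h := integral_quadrant (P := P) (S := S)
          (f := fun z : ℝ × ℝ => z.1 ^ 2 * φ z.1 z.2) ((by fun_prop : Measurable fun z : ℝ × ℝ =>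
            z.1 ^ 2).mul hφ)
        refine h.trans ?_
        have e : ∫ z : ℝ × ℝ, z.1 ^ 2 * (expTr P S z.1 * intWeight P S z.2 *
            (z.1 ^ 2 * φ z.1 z.2)) ∂quadrantMeasure = 0 := by
          refine Eq.trans (integral_congr_ae (Filter.Eventually.of_forall fun z => ?_)) hc
          simp only [intWeight]
          ring
        rw [e, mul_zero]
      have e2 : ∫ z : Vel × ℝ, ‖z.1 - S.u‖ ^ 2 * ((a * z.2 + b) *
          radialCoef P S a b φ ‖z.1 - S.u‖) ∂(velMeasure P S).prod (intMeasure P S) = 0 := by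
        have h := integral_prod_mul (μ := velMeasure P S) (ν := intMeasure P S)
          (fun ξ : Vel => ‖ξ - S.u‖ ^ 2 * radialCoef P S a b φ ‖ξ - S.u‖) fun I => a * I + b
        rw [h0, mul_zero] at h
        rw [← h]
        refine integral_congr_ae (Filter.Eventually.of_forall fun z => ?_)
        simp only
        ring
      have e3 : ∀ z : Vel × ℝ, ‖z.1 - S.u‖ ^ 2 * ((a * z.2 + b) *
          radialCoef P S a b φ ‖z.1 - S.u‖) =
          ‖z.1 - S.u‖ ^ 2 * φ ‖z.1 - S.u‖ z.2 - ‖z.1 - S.u‖ ^ 2 * D z := by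
        intro z
        rw [hDdef, radialResidual]
        ring
      simp_rw [e3] at e2
      rw [integral_sub i1 hDint] at e2
      linarith
  have hac : (velMeasure P S).prod (intMeasure P S) ≪
      (volume : Measure Vel).prod (intMeasure P S) :=
    (withDensity_absolutelyContinuous _ _).prod Measure.AbsolutelyContinuous.rfl
  have hpos : ∫ z : Vel × ℝ, ‖z.1 - S.u‖ ^ 2 ∂(velMeasure P S).prod (intMeasure P S) ≠ 0 := by
    intro h
    have h1 := integral_prod_mul (μ := velMeasure P S) (ν := intMeasure P S)
      (fun ξ : Vel => ‖ξ - S.u‖ ^ 2) fun _ => 1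
    simp only [mul_one] at h1
    rw [h, integral_const, smul_eq_mul, mul_one, intMeasure_real_univ] at h1
    have h2 := (mul_eq_zero.1 h1.symm).resolve_right (intMass_pos P S).ne'
    have h3 := (integral_eq_zero_iff_of_nonneg (fun ξ => sq_nonneg _)
      (integrable_norm_pow_velMeasure P S 2)).1 h2
    have h4 := (volume_ac_velMeasure P S).ae_le h3
    have h5 : ∀ᵐ ξ : Vel, False := by
      filter_upwards [h4, ae_coord_ne_zero S.u 0] with ξ h6 h7
      have h8 : ξ - S.u = 0 := norm_eq_zero.1 (pow_eq_zero_iff two_ne_zero |>.1 h6)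
      rw [h8] at h7
      exact h7 rfl
    rw [Filter.eventually_false_iff_eq_bot, ae_eq_bot] at h5
    exact NeZero.ne (volume : Measure Vel) h5
  filter_upwards [Measure.ae_ae_of_ae_prod hconst] with z hz
  -- `D` equals the number `D z` almost everywhere, so the vanishing moment is `D z` times a nonzero
  -- constant.
  have h : ∫ w, ‖w.1 - S.u‖ ^ 2 * D w ∂(velMeasure P S).prod (intMeasure P S) =
      ∫ w : Vel × ℝ, ‖w.1 - S.u‖ ^ 2 * D z ∂(velMeasure P S).prod (intMeasure P S) := by
    refine integral_congr_ae ?_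
    filter_upwards [hac.ae_le hz] with w hw
    rw [hw]
  rw [hmean, integral_mul_const] at h
  exact (mul_eq_zero.1 h.symm).resolve_left hpos

end Separation

end Reduction

/-! ### Convergence and factorization of the transport integrals. -/

section Transport

variable {P : Model} {S : FluidState}

/-- The two extra powers of `c` are the Jacobian of spherical coordinates. -/
theorem momentConverges_zeroth {φ : ℝ → ℝ → ℝ} (hφ : Measurable (Function.uncurry φ)) {k : ℕ}
    (h : Integrable (fun z : Vel × ℝ => ‖z.1 - S.u‖ ^ k * φ ‖z.1 - S.u‖ z.2)
      ((velMeasure P S).prod (intMeasure P S))) :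
    MomentConverges P S (k + 2) (P.δ / 2 - 1) φ := by
  have h1 := integrable_quadrant (f := fun z : ℝ × ℝ => z.1 ^ k * φ z.1 z.2)
    ((by fun_prop : Measurable fun z : ℝ × ℝ => z.1 ^ k).mul hφ) h
  refine h1.congr (Filter.Eventually.of_forall fun z => ?_)
  simp only [intWeight]
  ring

theorem momentConverges_first {φ : ℝ → ℝ → ℝ} (hφ : Measurable (Function.uncurry φ)) {k : ℕ}
    (h : Integrable (fun z : Vel × ℝ => ‖z.1 - S.u‖ ^ k * φ ‖z.1 - S.u‖ z.2 * z.2)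
      ((velMeasure P S).prod (intMeasure P S))) :
    MomentConverges P S (k + 2) (P.δ / 2) φ := by
  have h1 := integrable_quadrant (f := fun z : ℝ × ℝ => z.1 ^ k * φ z.1 z.2 * z.2)
    (((by fun_prop : Measurable fun z : ℝ × ℝ => z.1 ^ k).mul hφ).mul measurable_snd) h
  refine h1.congr ?_
  filter_upwards [ae_quadrant_pos] with z hz
  have : z.2 ^ (P.δ / 2) = z.2 ^ (P.δ / 2 - 1) * z.2 := by
    rw [← Real.rpow_add_one hz.2.ne', sub_add_cancel]
  simp only [intWeight, this]
  ring

/-- The function `|c| φ` is in `L²`, as are the monomials `|c|³`, `|c| I` and `|c|`. The products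
are integrable, and the Jacobian `c²` brings the powers of `c` to `6`, `4` and `4`. -/
theorem momentConverges_vector (hα : P.α = 0) {φ : ℝ → ℝ → ℝ}
    (hφ : Measurable (Function.uncurry φ))
    (h : ∀ i : Fin 3, InDomain P S fun ξ I => (ξ - S.u) i * φ ‖ξ - S.u‖ I) :
    MomentConverges P S 6 (P.δ / 2 - 1) φ ∧ MomentConverges P S 4 (P.δ / 2) φ ∧
      MomentConverges P S 4 (P.δ / 2 - 1) φ := by
  have h1 : MemLp (fun z : Vel × ℝ => ‖z.1 - S.u‖ * φ ‖z.1 - S.u‖ z.2) 2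
      ((velMeasure P S).prod (intMeasure P S)) :=
    memLp_norm_mul_of_vector (hφ.comp (measurable_radial S.u))
      fun i => (h i).memLp_domMeasure hα
  refine ⟨momentConverges_zeroth hφ ?_, momentConverges_first hφ ?_, momentConverges_zeroth hφ ?_⟩
  · refine ((memLp_norm_pow_mul_pow 3 0).integrable_mul h1).congr
      (Filter.Eventually.of_forall fun z => ?_)
    simp only [Pi.mul_apply]
    ring
  · refine ((memLp_norm_pow_mul_pow 1 1).integrable_mul h1).congr
      (Filter.Eventually.of_forall fun z => ?_)
    simp only [Pi.mul_apply]
    ring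
  · refine ((memLp_norm_pow_mul_pow 1 0).integrable_mul h1).congr
      (Filter.Eventually.of_forall fun z => ?_)
    simp only [Pi.mul_apply]
    ring

theorem momentConverges_tensor (hα : P.α = 0) {φ : ℝ → ℝ → ℝ}
    (hφ : Measurable (Function.uncurry φ))
    (h : ∀ i j : Fin 3, InDomain P S fun ξ I => Aij i j (ξ - S.u) * φ ‖ξ - S.u‖ I) :
    MomentConverges P S 6 (P.δ / 2 - 1) φ := by
  have h1 : MemLp (fun z : Vel × ℝ => ‖z.1 - S.u‖ ^ 2 * φ ‖z.1 - S.u‖ z.2) 2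
      ((velMeasure P S).prod (intMeasure P S)) :=
    memLp_norm_sq_mul_of_tensor (hφ.comp (measurable_radial S.u))
      fun i j => (h i j).memLp_domMeasure hα
  refine momentConverges_zeroth hφ (((memLp_norm_pow_mul_pow 2 0).integrable_mul h1).congr
    (Filter.Eventually.of_forall fun z => ?_))
  simp only [Pi.mul_apply]
  ring

/-- By Fubini almost every slice `I = const` is integrable; on a slice with `χ I ≠ 0` the energy
factor can be divided out. -/
theorem integrableOn_of_momentConverges {φ : ℝ → ℝ → ℝ} {φ₀ χ : ℝ → ℝ} {k : ℕ} {s : ℝ}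
    (hφ : ∀ᵐ z ∂quadrantMeasure, φ z.1 z.2 = χ z.2 * φ₀ z.1)
    (hχ : ∀ᵐ I ∂volume.restrict (Ioi (0 : ℝ)), χ I ≠ 0) (h : MomentConverges P S k s φ) :
    IntegrableOn (fun c => c ^ k * φ₀ c * expTr P S c) (Ioi 0) := by
  have h1 : Integrable (fun z : ℝ × ℝ => (z.1 ^ k * φ₀ z.1 * expTr P S z.1) *
      (χ z.2 * z.2 ^ s * expInt P S z.2)) quadrantMeasure := by
    refine h.congr ?_
    filter_upwards [hφ] with z hz
    rw [hz]
    ring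
  have h2 := Integrable.prod_left_ae h1
  have : (ae (volume.restrict (Ioi (0 : ℝ)))).NeBot := by
    rw [ae_neBot, Ne, Measure.restrict_eq_zero]
    simp
  obtain ⟨I, h3, h4, h5⟩ :=
    (h2.and (hχ.and (ae_restrict_mem measurableSet_Ioi))).exists
  have h6 : χ I * I ^ s * expInt P S I ≠ 0 :=
    mul_ne_zero (mul_ne_zero h4 (Real.rpow_pos_of_pos h5 s).ne') (expInt_pos P S I).ne'
  refine (h3.mul_const (χ I * I ^ s * expInt P S I)⁻¹).congr
    (Filter.Eventually.of_forall fun c => ?_)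
  exact mul_inv_cancel_right₀ h6 _

theorem iterated_moment {φ : ℝ → ℝ → ℝ} {φ₀ χ : ℝ → ℝ} (k : ℕ) (s : ℝ)
    (hφ : ∀ᵐ z ∂quadrantMeasure, φ z.1 z.2 = χ z.2 * φ₀ z.1) :
    ∫ I in Ioi (0 : ℝ), (∫ c in Ioi (0 : ℝ), c ^ k * φ c I * expTr P S c) * I ^ s * expInt P S I =
      (∫ I in Ioi (0 : ℝ), χ I * I ^ s * expInt P S I) *
        ∫ c in Ioi (0 : ℝ), c ^ k * φ₀ c * expTr P S c := by
  rw [← integral_mul_const]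
  have h1 : ∀ᵐ z ∂(volume.restrict (Ioi (0 : ℝ))).prod (volume.restrict (Ioi (0 : ℝ))),
      φ z.2 z.1 = χ z.1 * φ₀ z.2 :=
    Measure.measurePreserving_swap.quasiMeasurePreserving.ae hφ
  refine integral_congr_ae ?_
  filter_upwards [Measure.ae_ae_of_ae_prod h1] with I hI
  have h2 : ∫ c in Ioi (0 : ℝ), c ^ k * φ c I * expTr P S c =
      χ I * ∫ c in Ioi (0 : ℝ), c ^ k * φ₀ c * expTr P S c := by
    rw [← integral_const_mul]
    refine integral_congr_ae ?_
    filter_upwards [hI] with c hc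
    rw [hc]
    ring
  rw [h2]
  ring

/-- The double integral factors, and its energy factor is the positive mass of the Gamma law. -/
theorem reduced_constraint {φ : ℝ → ℝ → ℝ} {φ₀ : ℝ → ℝ}
    (hφ : ∀ᵐ z ∂quadrantMeasure, φ z.1 z.2 = 1 * φ₀ z.1) (hc : Constraint P S φ) :
    ∫ c in Ioi (0 : ℝ), c ^ 4 * φ₀ c * expTr P S c = 0 := by
  have h1 := integral_prod_mul (μ := volume.restrict (Ioi (0 : ℝ)))
    (ν := volume.restrict (Ioi (0 : ℝ))) (fun c => c ^ 4 * φ₀ c * expTr P S c)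
    fun I => I ^ (P.δ / 2 - 1) * expInt P S I
  rw [integral_zeroth] at h1
  have h2 : ∫ z : ℝ × ℝ, z.1 ^ 4 * φ₀ z.1 * expTr P S z.1 *
      (z.2 ^ (P.δ / 2 - 1) * expInt P S z.2) ∂quadrantMeasure = 0 := by
    rw [← hc]
    refine integral_congr_ae ?_
    filter_upwards [hφ] with z hz
    rw [hz]
    ring
  rw [quadrantMeasure, h1] at h2
  exact (mul_eq_zero.1 h2).resolve_right (intMass_pos P S).ne'

end Transport

end

end PolyatomicGas

/-! ### The reduced transport coefficients. -/

open PolyatomicGas in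
theorem mainTheorem9 (P : PolyatomicGas.Model) (hα : P.α = 0) (S : PolyatomicGas.FluidState)
    (𝒜 ℬ 𝒞 : ℝ → ℝ → ℝ) (hsol : PolyatomicGas.IsChapmanEnskog P S 𝒜 ℬ 𝒞) :
    PolyatomicGas.TransportConverges P S 𝒜 ℬ 𝒞 ∧
    (∃ 𝒜₀ ℬ₀ 𝒞₀ : ℝ → ℝ,
      Measurable 𝒜₀ ∧ Measurable ℬ₀ ∧ Measurable 𝒞₀ ∧
      -- the solutions separate
      (∀ᵐ z ∂PolyatomicGas.quadrantMeasure, 𝒜 z.1 z.2 = 𝒜₀ z.1) ∧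
      (∀ᵐ z ∂PolyatomicGas.quadrantMeasure, ℬ z.1 z.2 = ℬ₀ z.1) ∧
      (∀ᵐ z ∂PolyatomicGas.quadrantMeasure,
        𝒞 z.1 z.2 = (z.2 / (P.kB * S.Tint) - P.δ / 2) * 𝒞₀ z.1) ∧
      -- convergence of the reduced integrals
      IntegrableOn (fun c => c ^ 6 * 𝒜₀ c * PolyatomicGas.expTr P S c) (Ioi 0) ∧
      IntegrableOn (fun c => c ^ 4 * ℬ₀ c * PolyatomicGas.expTr P S c) (Ioi 0) ∧
      IntegrableOn (fun c => c ^ 6 * ℬ₀ c * PolyatomicGas.expTr P S c) (Ioi 0) ∧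
      IntegrableOn (fun c => c ^ 4 * 𝒞₀ c * PolyatomicGas.expTr P S c) (Ioi 0) ∧
      -- the reduced constraint
      (∫ c in Ioi (0 : ℝ), c ^ 4 * ℬ₀ c * PolyatomicGas.expTr P S c) = 0 ∧
      -- the reduced transport coefficients
      PolyatomicGas.LambdaMu P S 𝒜 =
        8 / (15 * √Real.pi) * S.ρ * (P.m / (2 * P.kB * S.Ttr)) ^ (5 / 2 : ℝ)
          * ∫ c in Ioi (0 : ℝ), c ^ 6 * 𝒜₀ c * PolyatomicGas.expTr P S c ∧
      PolyatomicGas.LambdaTrTr P S ℬ =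
        2 / (3 * √Real.pi) * S.ρ * (P.m / (2 * P.kB * S.Ttr)) ^ (3 / 2 : ℝ)
          * ∫ c in Ioi (0 : ℝ), c ^ 6 * ℬ₀ c * PolyatomicGas.expTr P S c ∧
      PolyatomicGas.LambdaIntInt P S 𝒞 =
        2 / (3 * √Real.pi) * P.δ * (S.ρ / P.m) * (P.m / (2 * P.kB * S.Ttr)) ^ (3 / 2 : ℝ)
          * (P.kB * S.Tint)
          * ∫ c in Ioi (0 : ℝ), c ^ 4 * 𝒞₀ c * PolyatomicGas.expTr P S c) ∧
    -- the cross-diffusion coefficients vanish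
    PolyatomicGas.LambdaIntTr P S 𝒞 = 0 ∧
    PolyatomicGas.LambdaTrInt P S ℬ = 0 := by
  have hk := kT_pos P S
  have hA : ∀ᵐ z ∂quadrantMeasure, 𝒜 z.1 z.2 = 1 * radialCoef P S 0 1 𝒜 z.1 := by
    filter_upwards [ae_separated_tensor hα hsol.measurable_A hsol.eq_A] with z hz
    rw [hz]; ring
  have hB : ∀ᵐ z ∂quadrantMeasure, ℬ z.1 z.2 = 1 * radialCoef P S 0 1 ℬ z.1 := by
    have h := ae_separated_vector (a := 0) (b := 1) (y := fun i ξ => Bi P S i (ξ - S.u)) hα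
      (Or.inr one_ne_zero) (Or.inl rfl) hsol.measurable_B
      (fun i => by simpa only [zero_mul, zero_add, mul_one] using hsol.eq_B i) hsol.constraint_B
    filter_upwards [h] with z hz
    rw [hz]; ring
  have hC : ∀ᵐ z ∂quadrantMeasure, 𝒞 z.1 z.2 = (z.2 / (P.kB * S.Tint) - P.δ / 2) *
      radialCoef P S (P.kB * S.Tint)⁻¹ (-(P.δ / 2)) 𝒞 z.1 := by
    have h := ae_separated_vector (a := (P.kB * S.Tint)⁻¹) (b := -(P.δ / 2))
      (y := fun i ξ => (ξ - S.u) i) hα (Or.inl (inv_pos.2 hk).ne')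
      (Or.inr (integral_affine_intMeasure P S)) hsol.measurable_C
      (fun i => by
        have e : (fun (ξ : Vel) I => (ξ - S.u) i * ((P.kB * S.Tint)⁻¹ * I + -(P.δ / 2))) =
            fun ξ I => Ci P S i (ξ - S.u) I := by
          funext ξ I
          rw [Ci]
          ring
        rw [e]
        exact hsol.eq_C i) hsol.constraint_C
    filter_upwards [h] with z hz
    rw [hz]; ring
  obtain ⟨b1, b2, b3⟩ := momentConverges_vector hα hsol.measurable_B fun i => (hsol.eq_B i).1
  obtain ⟨c1, c2, -⟩ := momentConverges_vector hα hsol.measurable_C fun i => (hsol.eq_C i).1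
  have a1 := momentConverges_tensor hα hsol.measurable_A fun i j => (hsol.eq_A i j).1
  have hone : ∀ᵐ I ∂volume.restrict (Ioi (0 : ℝ)), (fun _ : ℝ => (1 : ℝ)) I ≠ 0 :=
    Filter.Eventually.of_forall fun _ => one_ne_zero
  have hχ : ∀ᵐ I ∂volume.restrict (Ioi (0 : ℝ)),
      (fun I => I / (P.kB * S.Tint) - P.δ / 2) I ≠ 0 := by
    have : ∀ᵐ I : ℝ, I ≠ P.δ / 2 * (P.kB * S.Tint) := compl_mem_ae_iff.2 (measure_singleton _)
    filter_upwards [ae_restrict_of_ae this] with I hI h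
    exact hI ((div_eq_iff hk.ne').1 (sub_eq_zero.1 h))
  have hred := reduced_constraint hB hsol.constraint_B
  have hm := intMass_pos P S
  refine ⟨⟨a1, b1, c1, b2, c2⟩, ⟨radialCoef P S 0 1 𝒜, radialCoef P S 0 1 ℬ,
    radialCoef P S (P.kB * S.Tint)⁻¹ (-(P.δ / 2)) 𝒞, measurable_radialCoef hsol.measurable_A,
    measurable_radialCoef hsol.measurable_B, measurable_radialCoef hsol.measurable_C,
    by simpa only [one_mul] using hA, by simpa only [one_mul] using hB, hC,
    integrableOn_of_momentConverges hA hone a1, integrableOn_of_momentConverges hB hone b3,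
    integrableOn_of_momentConverges hB hone b1, integrableOn_of_momentConverges hC hχ c2, hred,
    ?_, ?_, ?_⟩, ?_, ?_⟩
  · rw [LambdaMu, iterated_moment (χ := fun _ => 1) 6 _ hA]
    simp only [one_mul]
    rw [integral_zeroth, ← intMass]
    field_simp
  · rw [LambdaTrTr, heatTr, iterated_moment (χ := fun _ => 1) 6 _ hB]
    simp only [one_mul]
    rw [integral_zeroth, ← intMass]
    field_simp
  · have := P.m_pos
    rw [LambdaIntInt, heatInt, iterated_moment (χ := fun I => I / (P.kB * S.Tint) - P.δ / 2) 4 _ hC,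
      integral_affine_first, ← intMass]
    field_simp
    ring
  -- The energy factor is the mean of the centred profile, which is zero.
  · rw [LambdaIntTr, heatTr, iterated_moment (χ := fun I => I / (P.kB * S.Tint) - P.δ / 2) 6 _ hC,
      integral_affine_zeroth, zero_mul, mul_zero]
  -- Here the velocity factor vanishes: it is the reduced constraint on `ℬ₀`.
  · rw [LambdaTrInt, heatInt, iterated_moment (χ := fun _ => 1) 4 _ hB, hred, mul_zero, mul_zero]
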